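/- Write $\tau(n)$ for the number of positive divisors of $n\ge 1$, and for a binary form $F\in\mathbb Z[t_1,t_2]$ let $h(F)$ be the maximum of the absolute values of its coefficients. For $f:\mathbb Z\to\mathbb C$, a real $T>0$ and an integer $q\ge 1$ put $$\mathcal E_f(T;q):=\max_{r\in\mathbb Z/q\mathbb Z}\ \sup_{v\in\mathbb R,\ |v|\le T}\Bigg|\sum_{\substack{n\in\mathbb Z,\ -T\le n\le v\\ n\equiv r\ (\mathrm{mod}\ q)}} f(n)\Bigg|.$$ Let $B,C,N>0$ be real and let $d\ge 1$ be an integer. Then there exists $\kappa=\kappa(B,C,d,N)>0$ such that the following holds. Let $f:\mathbb Z\to\mathbb C$ be any function with $|f(0)|\le B$ and $|f(n)|\le B\,\tau(|n|)^C$ for all $n\ne 0$. Then for all real $H\ge 3$ and all real $x$ with $(\log H)^\kappa\le x\le H$, $$\frac{1}{H^{1+d}}\sum_{\substack{F}}\Bigg|\frac1{x^2}\sum_{\mathbf n\in\mathbb Z^2\cap[-x,x]^2} f(F(\mathbf n))\Bigg|^2\ \ll\ \frac{(\log H)^\kappa x^{4d}}{H^2}\max_{\substack{q\in\mathbb Z\\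 1\le q\le 2x^{2d}}}\mathcal E_f\big((1+d)x^dH;q\big)^2+\frac1{(\log x)^N},$$ where $F$ runs over all binary forms in $\mathbb Z[t_1,t_2]$ of degree $d$ (including the zero form) with $h(F)\le H$, and the implied constant depends only on $B,C,d,N$. -/

import Mathlib

/-- The number of positive divisors of a natural number, `τ`. -/
def tau (n : ℕ) : ℕ := n.divisors.card

/-- The height `h(F)`: the maximum of the absolute values of the coefficients of `F`
(it is `0` for the zero form). -/
def formHeight (F : MvPolynomial (Fin 2) ℤ) : ℕ :=
  F.support.sup fun m => (F.coeff m).natAbs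

theorem natAbs_coeff_le_formHeight (F : MvPolynomial (Fin 2) ℤ) (m : Fin 2 →₀ ℕ) :
    (F.coeff m).natAbs ≤ formHeight F := by
  by_cases h : m ∈ F.support
  · exact Finset.le_sup (f := fun m => (F.coeff m).natAbs) h
  · simp [MvPolynomial.notMem_support_iff.mp h]

/-- There are finitely many integer binary forms of degree `d` and bounded height. -/
theorem finite_formsOfHeight (d : ℕ) (H : ℝ) :
    {F : MvPolynomial (Fin 2) ℤ | F.IsHomogeneous d ∧ (formHeight F : ℝ) ≤ H}.Finite := by
  have key : Set.MapsTo (fun (F : MvPolynomial (Fin 2) ℤ) (j : Fin (d + 1)) =>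
      F.coeff (Finsupp.single 0 (j : ℕ) + Finsupp.single 1 (d - j)))
      {F : MvPolynomial (Fin 2) ℤ | F.IsHomogeneous d ∧ (formHeight F : ℝ) ≤ H}
      (Set.Icc (fun _ => -(⌊H⌋₊ : ℤ)) (fun _ => (⌊H⌋₊ : ℤ))) := by
    rintro F ⟨-, hF⟩
    have h1 : formHeight F ≤ ⌊H⌋₊ := Nat.le_floor hF
    refine ⟨fun j => ?_, fun j => ?_⟩ <;>
    · have h2 := natAbs_coeff_le_formHeight F
        (Finsupp.single 0 (j : ℕ) + Finsupp.single 1 (d - j))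
      dsimp only
      omega
  refine Set.Finite.of_injOn key ?_ (Set.finite_Icc _ _)
  rintro F ⟨hF, -⟩ G ⟨hG, -⟩ h
  ext m
  by_cases hm : m.degree = d
  · have hs : m 0 + m 1 = d := by
      rw [← hm, Finsupp.degree_eq_sum, Fin.sum_univ_two]
    have hm' : m = Finsupp.single 0 (m 0) + Finsupp.single 1 (d - m 0) := by
      ext i
      fin_cases i
      · simp
      · simp; omega
    have := congrFun h ⟨m 0, by omega⟩
    dsimp only at this
    rwa [← hm'] at this
  · rw [hF.coeff_eq_zero hm, hG.coeff_eq_zero hm]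

/-- The integer binary forms of degree `d` (the zero form included) of height at most `H`. -/
noncomputable def formsOfHeight (d : ℕ) (H : ℝ) : Finset (MvPolynomial (Fin 2) ℤ) :=
  (finite_formsOfHeight d H).toFinset

/-- The integer points of the square `[-x, x]²`. -/
noncomputable def intBox (x : ℝ) : Finset (ℤ × ℤ) :=
  Finset.Icc ⌈-x⌉ ⌊x⌋ ×ˢ Finset.Icc ⌈-x⌉ ⌊x⌋

/-- The sum of `f n` over the integers `-T ≤ n ≤ v` with `n ≡ r` modulo `q`. -/
noncomputable def progressionSum (f : ℤ → ℂ) (T v : ℝ) (q : ℕ) (r : ZMod q) : ℂ :=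
  ∑ n ∈ (Finset.Icc ⌈-T⌉ ⌊v⌋).filter fun n : ℤ => (n : ZMod q) = r, f n

/-- The discrepancy `𝓔_f(T; q)`, the maximum over `r` of the supremum over `v ∈ [-T, T]` of
`|progressionSum f T v q r|`. -/
noncomputable def discrepancy (f : ℤ → ℂ) (T : ℝ) (q : ℕ) : ℝ :=
  ⨆ r : ZMod q, ⨆ v : Set.Icc (-T) T, ‖progressionSum f T v q r‖

/-- The suprema defining `discrepancy` are over bounded families. -/
theorem norm_progressionSum_le_discrepancy (f : ℤ → ℂ) {T v : ℝ} (hv : |v| ≤ T) {q : ℕ}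
    (hq : 0 < q) (r : ZMod q) : ‖progressionSum f T v q r‖ ≤ discrepancy f T q := by
  have : NeZero q := ⟨hq.ne'⟩
  have hb (r : ZMod q) : BddAbove (Set.range fun v : Set.Icc (-T) T =>
      ‖progressionSum f T v q r‖) := by
    refine ⟨∑ n ∈ Finset.Icc ⌈-T⌉ ⌊T⌋, ‖f n‖, ?_⟩
    rintro _ ⟨⟨w, hw⟩, rfl⟩
    refine (norm_sum_le _ _).trans
      (Finset.sum_le_sum_of_subset_of_nonneg ?_ fun _ _ _ => norm_nonneg _)
    exact (Finset.filter_subset _ _).trans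
      (Finset.Icc_subset_Icc le_rfl (Int.floor_le_floor hw.2))
  exact (le_ciSup (hb r) ⟨v, abs_le.mp hv⟩).trans
    (le_ciSup (f := fun r : ZMod q => ⨆ v : Set.Icc (-T) T, ‖progressionSum f T v q r‖)
      (Set.finite_range _).bddAbove r)

/-- The maximum of `𝓔_f(T; q)²` over the positive integers `q ≤ Q`. -/
noncomputable def maxSqDiscrepancy (f : ℤ → ℂ) (T Q : ℝ) : ℝ :=
  ⨆ q : {q : ℕ // 1 ≤ q ∧ (q : ℝ) ≤ Q}, discrepancy f T q ^ 2

/-! The proof is a dispersion argument. Expanding the square and exchanging sums gives, for each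
pair of points `n`, `m` of the box, a correlation of `f (F n)` with `f (F m)` over forms `F`
(`sum_norm_sum_sq_le`). Freeze all coefficients of `F` except those of `t₁^d` and `t₂^d`: then `F n`
and `F m` are affine-linear in the two free coefficients, with determinant `D = n.2^d * m.1^d -
n.1^d * m.2^d`.

If `D ≠ 0`, fix the value `k` of `F n`. The free coefficients then lie on a line, along which `F m`
runs through a full arithmetic progression in an interval, with modulus dividing `D`, hence at most
`2x^(2d)`. The inner sum is at most twice a discrepancy (`norm_sum_line_le`), and the sum of `‖f k‖`
over `k` costs only logarithms.

If `D = 0`, cancellation is not needed: a nonzero `n` is degenerate with only `O(x)` points `m`,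
which saves a factor `x`. By AM-GM it remains to bound second moments of `f (F n)`
(`exists_sum_norm_sq_linear_le`). The gcd of `n` is factored out at a cost of `√x` and logarithms.
For the remaining primitive linear form, `τ` is dominated by a power of `τ` at a divisor not
exceeding `H` (`exists_dvd_pow_le_tau_le`), and such divisors are equidistributed on the square of
coefficients.

After normalisation the degenerate pairs contribute a power of `log H` over `√x`, absorbed by `x ≥
(log H)^κ`. The independent pairs contribute the discrepancy to the first power; AM-GM turns this
into its square plus a negative power of `log H`. -/

/-! ### The divisor function: small divisors and moments. -/

theorem tau_pos {n : ℕ} (hn : n ≠ 0) : 0 < tau n :=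
  Finset.card_pos.mpr ⟨1, Nat.one_mem_divisors.mpr hn⟩

theorem tau_mul_le (a b : ℕ) : tau (a * b) ≤ tau a * tau b := by
  classical
  unfold tau
  rw [Nat.divisors_mul]
  exact Finset.card_mul_le

theorem tau_pow_le (a k : ℕ) : tau (a ^ k) ≤ tau a ^ k := by
  induction k with
  | zero => simp [tau]
  | succ k ih =>
    rw [pow_succ, pow_succ]
    exact (tau_mul_le _ _).trans (Nat.mul_le_mul_right _ ih)

theorem tau_mul_of_coprime {a b : ℕ} (h : a.Coprime b) : tau (a * b) = tau a * tau b :=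
  h.card_divisors_mul

theorem tau_prime_pow {p : ℕ} (hp : p.Prime) (k : ℕ) : tau (p ^ k) = k + 1 := by
  simp [tau, Nat.divisors_prime_pow hp]

/-- Every positive integer has a divisor below its square root that carries
a positive power of its divisor function. -/
theorem exists_dvd_sq_le_tau_le (m : ℕ) (hm : 0 < m) :
    ∃ e, e ∣ m ∧ e ^ 2 ≤ m ∧ tau m ≤ 2 * tau e ^ 2 := by
  induction m using Nat.strong_induction_on with
  | _ m ih =>
  by_cases hsq : ∃ p, p.Prime ∧ p ^ 2 ∣ m
  · obtain ⟨p, hp, hpm⟩ := hsq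
    obtain ⟨a, m', hpm', rfl⟩ := Nat.exists_eq_pow_mul_and_not_dvd hm.ne' p hp.ne_one
    have hm' : 0 < m' := Nat.pos_of_mul_pos_left hm
    have ha : 2 ≤ a := by
      by_contra! h
      have h1 : p ^ 2 ∣ p * m' := hpm.trans
        (Nat.mul_dvd_mul_right ((pow_dvd_pow p (by omega : a ≤ 1)).trans (by simp)) _)
      rw [pow_two] at h1
      exact hpm' (Nat.dvd_of_mul_dvd_mul_left hp.pos h1)
    have hlt : m' < p ^ a * m' :=
      lt_mul_of_one_lt_left hm' (Nat.one_lt_pow (by omega) hp.one_lt)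
    obtain ⟨e, he, he2, hte⟩ := ih m' hlt hm'
    have hc : p.Coprime m' := (Nat.Prime.coprime_iff_not_dvd hp).mpr hpm'
    have hce : p.Coprime e := hc.coprime_dvd_right he
    refine ⟨p ^ (a / 2) * e, Nat.mul_dvd_mul (pow_dvd_pow _ (Nat.div_le_self _ _)) he, ?_, ?_⟩
    · rw [mul_pow, ← pow_mul]
      exact Nat.mul_le_mul (Nat.pow_le_pow_right hp.pos (by omega)) he2
    · rw [tau_mul_of_coprime (hc.pow_left _), tau_mul_of_coprime (hce.pow_left _),
        tau_prime_pow hp, tau_prime_pow hp]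
      -- This fails for `a = 1`, which is why primes dividing `m` exactly once are handled in pairs
      -- below.
      have h1 : a + 1 ≤ (a / 2 + 1) ^ 2 := by
        have : a ≤ 2 * (a / 2) + 1 := by omega
        have : 1 ≤ a / 2 := by omega
        nlinarith
      calc (a + 1) * tau m' ≤ (a / 2 + 1) ^ 2 * (2 * tau e ^ 2) := Nat.mul_le_mul h1 hte
        _ = _ := by ring
  -- Squarefree case: of the two least primes `p < q`, keep only `p` in `e`. Then `p² ≤ pq`, while
  -- `τ(pq) = 4 = τ(p)²`, so the constant does not grow. The factor `2` of the statement is spent on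
  -- a single leftover prime.
  · push Not at hsq
    by_cases h1 : m = 1
    · exact ⟨1, by simp [h1], by simp [h1], by simp [h1, tau]⟩
    have hp := Nat.minFac_prime h1
    obtain ⟨m₁, hm₁⟩ := Nat.minFac_dvd m
    set p := m.minFac with hpdef
    by_cases h2 : m₁ = 1
    · refine ⟨1, by simp, by rw [one_pow]; exact hm, ?_⟩
      have : m = p ^ 1 := by simpa [h2] using hm₁
      rw [this, tau_prime_pow hp]
      simp [tau]
    have hq := Nat.minFac_prime h2
    obtain ⟨m', hm'⟩ := Nat.minFac_dvd m₁
    set q := m₁.minFac with hqdef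
    have hpq : p ≤ q := Nat.minFac_le_of_dvd hq.two_le ⟨p * m', by rw [hm₁, hm']; ring⟩
    have hmeq : m = p * (q * m') := by rw [hm₁, hm']
    have hne : p ≠ q := by
      intro h
      exact hsq p hp ⟨m', by rw [hmeq, ← h]; ring⟩
    have hpm' : ¬ p ∣ m' := by
      rintro ⟨k, hk⟩
      exact hsq p hp ⟨q * k, by rw [hmeq, hk]; ring⟩
    have hqm' : ¬ q ∣ m' := by
      rintro ⟨k, hk⟩
      exact hsq q hq ⟨p * k, by rw [hmeq, hk]; ring⟩
    have hm'0 : 0 < m' := by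
      rcases Nat.eq_zero_or_pos m' with h | h
      · simp [h] at hpm'
      · exact h
    have hlt : m' < m := by
      rw [hmeq]
      nlinarith [hp.two_le, hq.two_le, Nat.mul_le_mul hp.two_le hq.two_le]
    obtain ⟨e, he, he2, hte⟩ := ih m' hlt hm'0
    have hcp : p.Coprime m' := (Nat.Prime.coprime_iff_not_dvd hp).mpr hpm'
    have hcq : q.Coprime m' := (Nat.Prime.coprime_iff_not_dvd hq).mpr hqm'
    have hcpq : p.Coprime q := (Nat.coprime_primes hp hq).mpr hne
    have tp : tau p = 2 := by simpa using tau_prime_pow hp 1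
    have tq : tau q = 2 := by simpa using tau_prime_pow hq 1
    refine ⟨p * e, ?_, ?_, ?_⟩
    · rw [hmeq]
      exact Nat.mul_dvd_mul_left _ (he.mul_left _)
    · calc (p * e) ^ 2 = (p * p) * e ^ 2 := by ring
        _ ≤ (p * q) * m' := Nat.mul_le_mul (Nat.mul_le_mul_left _ hpq) he2
        _ = m := by rw [hmeq]; ring
    · rw [hmeq, tau_mul_of_coprime (hcpq.mul_right hcp), tau_mul_of_coprime hcq,
        tau_mul_of_coprime (hcp.coprime_dvd_right he), tp, tq]
      nlinarith

/-- Iteration of the square-root case. Its purpose is to replace a value as large as a fixed power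
of `H` by a divisor not exceeding `H`, short enough to be counted in residue classes. -/
theorem exists_dvd_pow_le_tau_le (s : ℕ) : ∃ K : ℕ, ∀ m : ℕ, 0 < m →
    ∃ e, e ∣ m ∧ e ^ 2 ^ s ≤ m ∧ tau m ≤ K * tau e ^ 2 ^ s := by
  induction s with
  | zero => exact ⟨1, fun m hm => ⟨m, dvd_rfl, by simp, by simp⟩⟩
  | succ s ih =>
    obtain ⟨K, hK⟩ := ih
    refine ⟨2 * K ^ 2, fun m hm => ?_⟩
    obtain ⟨e, he, hem, hte⟩ := exists_dvd_sq_le_tau_le m hm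
    obtain ⟨e', he', hem', hte'⟩ := hK e (Nat.pos_of_dvd_of_pos he hm)
    refine ⟨e', he'.trans he, ?_, ?_⟩
    · rw [pow_succ, pow_mul]
      exact (Nat.pow_le_pow_left hem' 2).trans hem
    · refine hte.trans ((Nat.mul_le_mul_left 2 (Nat.pow_le_pow_left hte' 2)).trans (le_of_eq ?_))
      rw [pow_succ 2 s, pow_mul]
      ring

/-- One factor `τ(n)` counts the factorisations `n = ab`. Submultiplicativity then separates `a`
from `b`, so raising the exponent by one squares the bound, starting from the harmonic sum. -/
theorem sum_tau_pow_div_le (A Y : ℕ) :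
    ∑ n ∈ Finset.Icc 1 Y, (tau n : ℝ) ^ A / n ≤ (1 + Real.log Y) ^ 2 ^ A := by
  induction A with
  | zero =>
    have := harmonic_le_one_add_log Y
    rw [harmonic_eq_sum_Icc] at this
    push_cast at this
    simpa using this
  | succ A ih =>
    have h1 : ∀ n ∈ Finset.Icc 1 Y, (tau n : ℝ) ^ (A + 1) / n =
        ∑ p ∈ (Finset.Icc 1 Y ×ˢ Finset.Icc 1 Y).filter fun p => p.1 * p.2 = n,
          (tau (p.1 * p.2) : ℝ) ^ A / ((p.1 * p.2 : ℕ) : ℝ) := by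
      intro n hn
      rw [Finset.mem_Icc] at hn
      have h2 : ((Finset.Icc 1 Y ×ˢ Finset.Icc 1 Y).filter fun p => p.1 * p.2 = n)
          = n.divisorsAntidiagonal := by
        ext ⟨a, b⟩
        simp only [Finset.mem_filter, Finset.mem_product, Finset.mem_Icc,
          Nat.mem_divisorsAntidiagonal]
        constructor
        · rintro ⟨-, h⟩
          exact ⟨h, by omega⟩
        · rintro ⟨h, -⟩
          have ha : 0 < a := Nat.pos_of_ne_zero (by rintro rfl; omega)
          have hb : 0 < b := Nat.pos_of_ne_zero (by rintro rfl; omega)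
          have := Nat.le_mul_of_pos_right a hb
          have := Nat.le_mul_of_pos_left b ha
          exact ⟨⟨⟨ha, by omega⟩, ⟨hb, by omega⟩⟩, h⟩
      rw [Finset.sum_congr rfl (g := fun _ => (tau n : ℝ) ^ A / n), Finset.sum_const, h2,
        ← Nat.map_div_right_divisors, Finset.card_map, nsmul_eq_mul]
      · change _ = (tau n : ℝ) * _
        ring
      · intro p hp
        rw [(Finset.mem_filter.mp hp).2]
    rw [Finset.sum_congr rfl h1]
    refine (Finset.sum_fiberwise_le_sum_of_sum_fiber_nonneg (fun _ _ =>
      Finset.sum_nonneg fun _ _ => by positivity)).trans ?_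
    have h3 : ∀ p ∈ Finset.Icc 1 Y ×ˢ Finset.Icc 1 Y,
        (tau (p.1 * p.2) : ℝ) ^ A / ((p.1 * p.2 : ℕ) : ℝ) ≤
          ((tau p.1 : ℝ) ^ A / p.1) * ((tau p.2 : ℝ) ^ A / p.2) := by
      intro p hp
      rw [div_mul_div_comm, ← mul_pow, Nat.cast_mul]
      gcongr
      exact_mod_cast tau_mul_le _ _
    refine (Finset.sum_le_sum h3).trans ?_
    rw [Finset.sum_product]
    dsimp only
    rw [← Finset.sum_mul_sum, ← pow_two, pow_succ 2 A, pow_mul]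
    exact pow_le_pow_left₀ (Finset.sum_nonneg fun _ _ => by positivity) ih 2

theorem sum_tau_pow_le (A Y : ℕ) :
    ∑ n ∈ Finset.Icc 1 Y, (tau n : ℝ) ^ A ≤ Y * (1 + Real.log Y) ^ 2 ^ A := by
  refine le_trans ?_ (mul_le_mul_of_nonneg_left (sum_tau_pow_div_le A Y) (Nat.cast_nonneg _))
  rw [Finset.mul_sum]
  refine Finset.sum_le_sum fun n hn => ?_
  rw [Finset.mem_Icc] at hn
  have h0 : (0 : ℝ) < n := by exact_mod_cast hn.1
  have h1 : (n : ℝ) ≤ Y := by exact_mod_cast hn.2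
  rw [mul_div_assoc', le_div_iff₀ h0, mul_comm]
  gcongr

theorem tau_pow_le_mul_log (A n : ℕ) (hn : 0 < n) :
    (tau n : ℝ) ^ A ≤ n * (1 + Real.log n) ^ 2 ^ A :=
  (Finset.single_le_sum (f := fun n : ℕ => (tau n : ℝ) ^ A) (fun _ _ => by positivity)
    (Finset.mem_Icc.mpr ⟨hn, le_rfl⟩)).trans (sum_tau_pow_le A n)

/-! ### Correlations along two independent linear forms. -/

theorem discrepancy_nonneg (f : ℤ → ℂ) (T : ℝ) (q : ℕ) : 0 ≤ discrepancy f T q :=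
  Real.iSup_nonneg fun _ => Real.iSup_nonneg fun _ => norm_nonneg _

/-- A progression inside an interval is a difference of two initial progressions. -/
theorem norm_sum_Icc_filter_le (f : ℤ → ℂ) {T : ℝ} {q : ℕ} (hq : 0 < q) (r : ZMod q)
    {lo hi : ℤ} (hle : lo ≤ hi) (hlo : -T ≤ lo) (hhi : (hi : ℝ) ≤ T) :
    ‖∑ n ∈ (Finset.Icc lo hi).filter fun n : ℤ => (n : ZMod q) = r, f n‖
      ≤ 2 * discrepancy f T q := by
  have hle' : (lo : ℝ) ≤ hi := by exact_mod_cast hle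
  have hlo' : ⌈-T⌉ ≤ lo := Int.ceil_le.mpr hlo
  have hunion : (Finset.Icc ⌈-T⌉ hi).filter (fun n : ℤ => (n : ZMod q) = r) =
      ((Finset.Icc ⌈-T⌉ (lo - 1)).filter fun n : ℤ => (n : ZMod q) = r) ∪
        (Finset.Icc lo hi).filter fun n : ℤ => (n : ZMod q) = r := by
    rw [← Finset.filter_union]
    congr 1
    ext n
    simp only [Finset.mem_union, Finset.mem_Icc]
    omega
  have hdisj : Disjoint ((Finset.Icc ⌈-T⌉ (lo - 1)).filter fun n : ℤ => (n : ZMod q) = r)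
      ((Finset.Icc lo hi).filter fun n : ℤ => (n : ZMod q) = r) := by
    refine Finset.disjoint_filter_filter (Finset.disjoint_left.mpr fun n hn hn' => ?_)
    rw [Finset.mem_Icc] at hn hn'
    omega
  have hhi' : ‖∑ n ∈ (Finset.Icc ⌈-T⌉ hi).filter (fun n : ℤ => (n : ZMod q) = r), f n‖
      ≤ discrepancy f T q := by
    have := norm_progressionSum_le_discrepancy f (T := T) (v := hi)
      (abs_le.mpr ⟨hlo.trans hle', hhi⟩) hq r
    rwa [progressionSum, Int.floor_intCast] at this
  have hlow : ‖∑ n ∈ (Finset.Icc ⌈-T⌉ (lo - 1)).filter (fun n : ℤ => (n : ZMod q) = r), f n‖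
      ≤ discrepancy f T q := by
    by_cases hc : ⌈-T⌉ ≤ lo - 1
    · have h1 : -T ≤ ((lo - 1 : ℤ) : ℝ) := Int.ceil_le.mp hc
      have h2 : ((lo - 1 : ℤ) : ℝ) ≤ T := by push_cast; linarith
      have := norm_progressionSum_le_discrepancy f (abs_le.mpr ⟨h1, h2⟩) hq r
      rwa [progressionSum, Int.floor_intCast] at this
    · rw [Finset.Icc_eq_empty hc]
      simpa using discrepancy_nonneg f T q
  rw [hunion, Finset.sum_union hdisj] at hhi'
  have hsplit (z w : ℂ) : ‖w‖ ≤ ‖z + w‖ + ‖z‖ := by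
    simpa using norm_sub_le (z + w) z
  linarith [hsplit
    (∑ n ∈ (Finset.Icc ⌈-T⌉ (lo - 1)).filter (fun n : ℤ => (n : ZMod q) = r), f n)
    (∑ n ∈ (Finset.Icc lo hi).filter (fun n : ℤ => (n : ZMod q) = r), f n)]

/-- A step of `t / s` of the way between two points of an interval stays in it. -/
theorem add_mul_mem_Icc {a s t c lo hi : ℤ} (h1 : a ∈ Set.Icc lo hi)
    (h2 : a + s * c ∈ Set.Icc lo hi) (ht : 0 ≤ t ∧ t ≤ s ∨ s ≤ t ∧ t ≤ 0) :
    a + t * c ∈ Set.Icc lo hi := by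
  obtain ⟨h1, h1'⟩ := h1
  obtain ⟨h2, h2'⟩ := h2
  rcases le_total 0 c with hc | hc <;> rcases ht with ⟨h3, h4⟩ | ⟨h3, h4⟩ <;>
    constructor <;> nlinarith

/-- On a line `p.1 * α + p.2 * β = k` in a square, an independent linear form
runs through a progression in an interval. -/
theorem norm_sum_line_le (f : ℤ → ℂ) {T E : ℝ} {α β γ δ v h : ℤ} (k : ℤ)
    (hD : α * δ - β * γ ≠ 0) (hE0 : 0 ≤ E)
    (hv : ∀ a ∈ Finset.Icc (-h) h, ∀ b ∈ Finset.Icc (-h) h,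
      |((a * γ + b * δ + v : ℤ) : ℝ)| ≤ T)
    (hE : ∀ q : ℕ, 0 < q → q ≤ (α * δ - β * γ).natAbs → discrepancy f T q ≤ E) :
    ‖∑ p ∈ (Finset.Icc (-h) h ×ˢ Finset.Icc (-h) h).filter fun p => p.1 * α + p.2 * β = k,
      f (p.1 * γ + p.2 * δ + v)‖ ≤ 2 * E := by
  classical
  set S := (Finset.Icc (-h) h ×ˢ Finset.Icc (-h) h).filter fun p : ℤ × ℤ =>
    p.1 * α + p.2 * β = k with hS
  have memS : ∀ p : ℤ × ℤ, p ∈ S ↔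
      (p.1 ∈ Set.Icc (-h) h ∧ p.2 ∈ Set.Icc (-h) h) ∧ p.1 * α + p.2 * β = k := by
    intro p
    simp [hS, Finset.mem_filter, Finset.mem_product]
  rcases S.eq_empty_or_nonempty with hempty | hne
  · rw [hempty]
    simpa using hE0
  set g : ℤ := (Int.gcd α β : ℤ) with hg
  have hαβ : α ≠ 0 ∨ β ≠ 0 := by
    by_contra! hcon
    exact hD (by simp [hcon.1, hcon.2])
  have hgpos : 0 < Int.gcd α β := by
    rw [Int.gcd_pos_iff]
    exact hαβ
  obtain ⟨α', β', hcop, hα, hβ⟩ := Int.exists_gcd_one hgpos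
  have hg0 : (Int.gcd α β : ℤ) ≠ 0 := by exact_mod_cast hgpos.ne'
  rw [← hg] at hα hβ hg0
  -- The primitive direction of the line is `(β', -α')`, and `w` is the increment of the second form
  -- along it. As the determinant is `-(g * w)`, the modulus `|w|` is at most its absolute value.
  set w : ℤ := γ * β' - δ * α' with hw
  have hDw : α * δ - β * γ = -(g * w) := by rw [hα, hβ, hw]; ring
  have hw0 : w ≠ 0 := by
    intro hw0
    exact hD (by rw [hDw, hw0]; ring)
  have hwle : w.natAbs ≤ (α * δ - β * γ).natAbs := by
    rw [hDw, Int.natAbs_neg, Int.natAbs_mul]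
    exact Nat.le_mul_of_pos_left _ (Int.natAbs_pos.mpr hg0)
  set φ : ℤ × ℤ → ℤ := fun p => p.1 * γ + p.2 * δ + v with hφ
  have hpar : ∀ p ∈ S, ∀ p' ∈ S, ∃ t : ℤ, p' = (p.1 + t * β', p.2 + t * (-α')) := by
    intro p hp p' hp'
    have h1 := ((memS p).mp hp).2
    have h2 := ((memS p').mp hp').2
    obtain ⟨x, y, hxy⟩ := Int.isCoprime_iff_gcd_eq_one.mpr hcop
    have h3 : (p'.1 - p.1) * α' + (p'.2 - p.2) * β' = 0 := by
      apply mul_right_cancel₀ hg0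
      rw [hα, hβ] at h1 h2
      linear_combination h2 - h1
    refine ⟨(p'.1 - p.1) * y - (p'.2 - p.2) * x, Prod.ext ?_ ?_⟩
    · linear_combination -(p'.1 - p.1) * hxy + x * h3
    · linear_combination -(p'.2 - p.2) * hxy + y * h3
  have hφpar : ∀ (p : ℤ × ℤ) (t : ℤ), φ (p.1 + t * β', p.2 + t * (-α')) = φ p + t * w := by
    intro p t
    simp only [hφ, hw]
    ring
  have hinj : Set.InjOn φ S := by
    intro p hp p' hp' h
    obtain ⟨t, ht⟩ := hpar p hp p' hp'
    have ht0 : t = 0 := by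
      rw [ht, hφpar] at h
      have : t * w = 0 := by linarith
      exact (mul_eq_zero.mp this).resolve_right hw0
    rw [ht, ht0]
    simp
  set L := S.image φ with hL
  have hLne : L.Nonempty := hne.image φ
  have hbound : ∀ l ∈ L, |(l : ℝ)| ≤ T := by
    intro l hl
    obtain ⟨p, hp, rfl⟩ := Finset.mem_image.mp hl
    have := (memS p).mp hp
    exact hv _ (Finset.mem_Icc.mpr this.1.1) _ (Finset.mem_Icc.mpr this.1.2)
  obtain ⟨p₁, hp₁, hp₁lo⟩ := Finset.mem_image.mp (L.min'_mem hLne)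
  obtain ⟨p₂, hp₂, hp₂hi⟩ := Finset.mem_image.mp (L.max'_mem hLne)
  obtain ⟨s, hs⟩ := hpar p₁ hp₁ p₂ hp₂
  have hlohi : L.max' hLne = L.min' hLne + s * w := by
    rw [← hp₁lo, ← hp₂hi, hs, hφpar]
  -- No term of the progression is missing: a term between the extremes corresponds to a lattice
  -- point between `p₁` and `p₂` on the line, and the square is convex.
  have hLeq : L = (Finset.Icc (L.min' hLne) (L.max' hLne)).filter
      fun n : ℤ => (n : ZMod w.natAbs) = ((L.min' hLne : ℤ) : ZMod w.natAbs) := by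
    ext l
    rw [Finset.mem_filter, Finset.mem_Icc, eq_comm (a := (l : ZMod w.natAbs)),
      ZMod.intCast_eq_intCast_iff_dvd_sub, Int.natAbs_dvd]
    constructor
    · intro hl
      refine ⟨⟨L.min'_le l hl, L.le_max' l hl⟩, ?_⟩
      obtain ⟨p, hp, rfl⟩ := Finset.mem_image.mp hl
      obtain ⟨t, ht⟩ := hpar p₁ hp₁ p hp
      exact ⟨t, by rw [ht, hφpar, ← hp₁lo]; ring⟩
    · rintro ⟨⟨h1, h2⟩, t, ht⟩
      have hl : l = L.min' hLne + t * w := by linarith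
      have htw : 0 ≤ t ∧ t ≤ s ∨ s ≤ t ∧ t ≤ 0 := by
        rw [hlohi] at h2
        rcases lt_or_gt_of_ne hw0 with hneg | hpos
        · right
          constructor <;> nlinarith
        · left
          constructor <;> nlinarith
      obtain ⟨hm₁, hk₁⟩ := (memS p₁).mp hp₁
      obtain ⟨hm₂, -⟩ := (memS p₂).mp hp₂
      rw [hs] at hm₂
      refine Finset.mem_image.mpr ⟨(p₁.1 + t * β', p₁.2 + t * (-α')), (memS _).mpr
        ⟨⟨add_mul_mem_Icc hm₁.1 hm₂.1 htw, add_mul_mem_Icc hm₁.2 hm₂.2 htw⟩, ?_⟩, ?_⟩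
      · rw [← hk₁, hα, hβ]
        ring
      · rw [hφpar, hp₁lo, hl]
  have hsum : ∑ p ∈ S, f (p.1 * γ + p.2 * δ + v) = ∑ l ∈ L, f l := by
    rw [hL, Finset.sum_image hinj]
  rw [hsum, hLeq]
  refine (norm_sum_Icc_filter_le f (Int.natAbs_pos.mpr hw0) _ (L.min'_le _ (L.max'_mem hLne))
    (abs_le.mp (hbound _ (L.min'_mem hLne))).1 (abs_le.mp (hbound _ (L.max'_mem hLne))).2).trans ?_
  linarith [hE _ (Int.natAbs_pos.mpr hw0) hwle]

/-- Group the points by the value `k` of the first form: `f k` is constant on the fibre and is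
bounded trivially, and all cancellation comes from the second form along the line. -/
theorem norm_sum_mul_conj_le (f : ℤ → ℂ) {T E : ℝ} {α β γ δ u v h : ℤ}
    (hD : α * δ - β * γ ≠ 0) (hE0 : 0 ≤ E)
    (hu : ∀ a ∈ Finset.Icc (-h) h, ∀ b ∈ Finset.Icc (-h) h,
      |((a * α + b * β + u : ℤ) : ℝ)| ≤ T)
    (hv : ∀ a ∈ Finset.Icc (-h) h, ∀ b ∈ Finset.Icc (-h) h,
      |((a * γ + b * δ + v : ℤ) : ℝ)| ≤ T)
    (hE : ∀ q : ℕ, 0 < q → q ≤ (α * δ - β * γ).natAbs → discrepancy f T q ≤ E) :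
    ‖∑ p ∈ Finset.Icc (-h) h ×ˢ Finset.Icc (-h) h,
      f (p.1 * α + p.2 * β + u) * starRingEnd ℂ (f (p.1 * γ + p.2 * δ + v))‖ ≤
      (∑ k ∈ Finset.Icc ⌈-T⌉ ⌊T⌋, ‖f k‖) * (2 * E) := by
  classical
  have hmaps : ∀ p ∈ Finset.Icc (-h) h ×ˢ Finset.Icc (-h) h,
      p.1 * α + p.2 * β + u ∈ Finset.Icc ⌈-T⌉ ⌊T⌋ := by
    intro p hp
    rw [Finset.mem_product] at hp
    have := abs_le.mp (hu _ hp.1 _ hp.2)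
    exact Finset.mem_Icc.mpr ⟨Int.ceil_le.mpr this.1, Int.le_floor.mpr this.2⟩
  rw [← Finset.sum_fiberwise_of_maps_to hmaps, Finset.sum_mul]
  refine (norm_sum_le _ _).trans (Finset.sum_le_sum fun k _ => ?_)
  have hfib : ∑ p ∈ Finset.Icc (-h) h ×ˢ Finset.Icc (-h) h with p.1 * α + p.2 * β + u = k,
      f (p.1 * α + p.2 * β + u) * starRingEnd ℂ (f (p.1 * γ + p.2 * δ + v)) =
      f k * starRingEnd ℂ (∑ p ∈ (Finset.Icc (-h) h ×ˢ Finset.Icc (-h) h).filter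
        fun p => p.1 * α + p.2 * β = k - u, f (p.1 * γ + p.2 * δ + v)) := by
    rw [map_sum, Finset.mul_sum]
    refine Finset.sum_congr ?_ fun p hp => ?_
    · ext p
      simp only [Finset.mem_filter]
      exact and_congr_right fun _ => by constructor <;> intro h <;> linarith
    · have := (Finset.mem_filter.mp hp).2
      rw [show p.1 * α + p.2 * β + u = k by linarith]
  rw [hfib, norm_mul, RCLike.norm_conj]
  exact mul_le_mul_of_nonneg_left (norm_sum_line_le f (k - u) hD hE0 hv hE) (norm_nonneg _)

/-! ### Divisor moments of a primitive linear form. -/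

/-- The set lies in one residue class modulo `g`, so it has at most `2h/g + 1` elements; the `1` is
absorbed because `g ≤ H`. -/
theorem card_le_of_pairwise_dvd {h : ℕ} {g : ℤ} (hg : 0 < g) {S : Finset ℤ}
    (hS : S ⊆ Finset.Icc (-(h : ℤ)) h) (hd : ∀ a ∈ S, ∀ b ∈ S, g ∣ a - b) {H : ℝ}
    (hH : (h : ℝ) ≤ H) (hgH : (g : ℝ) ≤ H) : (S.card : ℝ) ≤ 3 * H / g := by
  have hg' : (0 : ℝ) < g := by exact_mod_cast hg
  have hcard : S.card ≤ (Finset.Icc (0 : ℤ) (2 * h / g)).card := by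
    refine Finset.card_le_card_of_injOn (fun n => (n + h) / g) ?_ ?_
    · intro n hn
      have := Finset.mem_Icc.mp (hS hn)
      refine Finset.mem_coe.mpr (Finset.mem_Icc.mpr ⟨Int.ediv_nonneg (by omega) hg.le, ?_⟩)
      exact Int.ediv_le_ediv hg (by omega)
    · intro a ha b hb hab
      dsimp only at hab
      have h1 := Int.mul_ediv_add_emod (a + h) g
      have h2 := Int.mul_ediv_add_emod (b + h) g
      have h3 : (a + h) % g = (b + h) % g :=
        Int.modEq_iff_dvd.mpr (by rw [add_sub_add_right_eq_sub]; exact hd b hb a ha)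
      rw [hab, h3] at h1
      omega
  have hq : (0 : ℤ) ≤ 2 * h / g := Int.ediv_nonneg (by positivity) hg.le
  rw [Int.card_Icc] at hcard
  have h1 : (S.card : ℤ) ≤ 2 * h / g + 1 := by omega
  have h2 : (S.card : ℝ) ≤ ((2 * h / g : ℤ) : ℝ) + 1 := by exact_mod_cast h1
  have h3 : ((2 * h / g : ℤ) : ℝ) * g ≤ 2 * h := by
    exact_mod_cast Int.ediv_mul_le (2 * (h : ℤ)) hg.ne'
  rw [le_div_iff₀ hg']
  nlinarith

/-- The number of points of a square at which a primitive linear form is divisible by `e`. -/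
theorem card_dvd_linear_le {h : ℕ} {H : ℝ} (hH : (h : ℝ) ≤ H) {α β : ℤ} (u : ℤ)
    (hc : IsCoprime α β) {e : ℕ} (he : 0 < e) (heH : (e : ℝ) ≤ H) :
    (((Finset.Icc (-(h : ℤ)) h ×ˢ Finset.Icc (-(h : ℤ)) h).filter
      fun p => (e : ℤ) ∣ p.1 * α + p.2 * β + u).card : ℝ) ≤ 9 * H ^ 2 / e := by
  classical
  have he' : (0 : ℝ) < e := by exact_mod_cast he
  have hH0 : 0 < H := he'.trans_le heH
  have hgpos : 0 < Int.gcd α e := Int.gcd_pos_of_ne_zero_right _ (by exact_mod_cast he.ne')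
  obtain ⟨α', e', hcop, hα, hee⟩ := Int.exists_gcd_one hgpos
  set g : ℤ := (Int.gcd α e : ℤ) with hg
  have hg0 : 0 < g := Int.natCast_pos.mpr hgpos
  have he'0 : 0 < e' := by
    have : (0 : ℤ) < e' * g := by rw [← hee]; exact_mod_cast he
    exact pos_of_mul_pos_left this hg0.le
  have hgR : (1 : ℝ) ≤ g := by exact_mod_cast hg0
  have heR : (1 : ℝ) ≤ e' := by exact_mod_cast he'0
  have hprod : (e : ℝ) = e' * g := by exact_mod_cast hee
  have hgH : (g : ℝ) ≤ H := by nlinarith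
  have heH' : (e' : ℝ) ≤ H := by nlinarith
  have hge : g ∣ (e : ℤ) := ⟨e', by rw [hee]; ring⟩
  have hgα : g ∣ α := ⟨α', by rw [hα]; ring⟩
  set I := Finset.Icc (-(h : ℤ)) h with hI
  -- With `g = gcd(α, e)`, divisibility by `g` involves `b` alone and fixes its class, since `β` is
  -- prime to `g`. Given `b`, the class of `a` modulo `e' = e/g` is fixed. The two counts multiply
  -- to `9H²/e`.
  set Bs := I.filter fun b => g ∣ b * β + u with hBs
  have hBcard : (Bs.card : ℝ) ≤ 3 * H / g := by
    refine card_le_of_pairwise_dvd hg0 (Finset.filter_subset _ _) ?_ hH hgH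
    intro a ha b hb
    have h1 := dvd_sub (Finset.mem_filter.mp ha).2 (Finset.mem_filter.mp hb).2
    have h2 : g ∣ (a - b) * β := by
      rwa [show a * β + u - (b * β + u) = (a - b) * β by ring] at h1
    exact (hc.of_isCoprime_of_dvd_left hgα).dvd_of_dvd_mul_right h2
  have hmaps : ∀ p ∈ (I ×ˢ I).filter (fun p => (e : ℤ) ∣ p.1 * α + p.2 * β + u),
      p.2 ∈ Bs := by
    intro p hp
    obtain ⟨h1, h2⟩ := Finset.mem_filter.mp hp
    refine Finset.mem_filter.mpr ⟨(Finset.mem_product.mp h1).2, ?_⟩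
    have h3 := dvd_sub (hge.trans h2) (hgα.mul_left p.1)
    rwa [show p.1 * α + p.2 * β + u - p.1 * α = p.2 * β + u by ring] at h3
  rw [Finset.card_eq_sum_card_fiberwise hmaps]
  push_cast
  have hfib : ∀ b ∈ Bs, ((((I ×ˢ I).filter (fun p => (e : ℤ) ∣ p.1 * α + p.2 * β + u)).filter
      fun p => p.2 = b).card : ℝ) ≤ 3 * H / e' := by
    intro b _
    set S := ((I ×ˢ I).filter (fun p => (e : ℤ) ∣ p.1 * α + p.2 * β + u)).filter
      fun p => p.2 = b with hS
    have hcard : (S.image Prod.fst).card = S.card := by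
      refine Finset.card_image_of_injOn fun p hp p' hp' h => Prod.ext h ?_
      rw [(Finset.mem_filter.mp hp).2, (Finset.mem_filter.mp hp').2]
    rw [← hcard]
    refine card_le_of_pairwise_dvd he'0 ?_ ?_ hH heH'
    · intro a ha
      obtain ⟨p, hp, rfl⟩ := Finset.mem_image.mp ha
      exact (Finset.mem_product.mp (Finset.mem_filter.mp (Finset.mem_filter.mp hp).1).1).1
    · intro a ha a' ha'
      obtain ⟨p, hp, rfl⟩ := Finset.mem_image.mp ha
      obtain ⟨p', hp', rfl⟩ := Finset.mem_image.mp ha'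
      obtain ⟨hp1, hp2⟩ := Finset.mem_filter.mp hp
      obtain ⟨hp1', hp2'⟩ := Finset.mem_filter.mp hp'
      have h1 := dvd_sub (Finset.mem_filter.mp hp1).2 (Finset.mem_filter.mp hp1').2
      have h2 : e' * g ∣ ((p.1 - p'.1) * α') * g := by
        rw [← hee, mul_assoc, ← hα]
        rw [hp2, hp2'] at h1
        rwa [show p.1 * α + b * β + u - (p'.1 * α + b * β + u) = (p.1 - p'.1) * α by ring] at h1
      have h3 := Int.dvd_of_mul_dvd_mul_right hg0.ne' h2
      exact (Int.isCoprime_iff_gcd_eq_one.mpr hcop).symm.dvd_of_dvd_mul_right h3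
  refine (Finset.sum_le_sum hfib).trans ?_
  rw [Finset.sum_const, nsmul_eq_mul]
  calc (Bs.card : ℝ) * (3 * H / e') ≤ (3 * H / g) * (3 * H / e') := by gcongr
    _ = _ := by rw [hprod]; field_simp; ring

/-- Moments of the divisor function along the values of a primitive linear form on a square. -/
theorem exists_sum_tau_linear_le (A d : ℕ) : ∃ K : ℝ, 0 < K ∧ ∃ M : ℕ,
    ∀ (H : ℝ) (h : ℕ) (α β u : ℤ), 1 ≤ H → (h : ℝ) ≤ H → IsCoprime α β →
    (∀ a ∈ Finset.Icc (-(h : ℤ)) h, ∀ b ∈ Finset.Icc (-(h : ℤ)) h,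
      |((a * α + b * β + u : ℤ) : ℝ)| ≤ H ^ (d + 1)) →
    ∑ p ∈ Finset.Icc (-(h : ℤ)) h ×ˢ Finset.Icc (-(h : ℤ)) h,
      (if p.1 * α + p.2 * β + u = 0 then (0 : ℝ)
        else (tau (p.1 * α + p.2 * β + u).natAbs : ℝ) ^ A) ≤
      K * H ^ 2 * (1 + Real.log H) ^ M := by
  classical
  obtain ⟨K, hK⟩ := exists_dvd_pow_le_tau_le (d + 1)
  set A' := 2 ^ (d + 1) * A with hA'
  -- The summand `1` only makes the constant visibly positive.
  refine ⟨(K : ℝ) ^ A * 9 + 1, by positivity, 2 ^ A', fun H h α β u hH1 hH hc hb => ?_⟩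
  have hH0 : 0 ≤ H := zero_le_one.trans hH1
  have hL : 0 ≤ Real.log H := Real.log_nonneg hH1
  set I := Finset.Icc (-(h : ℤ)) h with hI
  have hpt : ∀ p ∈ I ×ˢ I, (if p.1 * α + p.2 * β + u = 0 then (0 : ℝ)
        else (tau (p.1 * α + p.2 * β + u).natAbs : ℝ) ^ A) ≤
      ∑ e ∈ Finset.Icc 1 ⌊H⌋₊, if (e : ℤ) ∣ p.1 * α + p.2 * β + u then
        (K : ℝ) ^ A * (tau e : ℝ) ^ A' else 0 := by
    intro p hp
    have hp' := Finset.mem_product.mp hp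
    have hbp := hb _ hp'.1 _ hp'.2
    set k := p.1 * α + p.2 * β + u with hk
    have hnn : ∀ e ∈ Finset.Icc 1 ⌊H⌋₊, (0 : ℝ) ≤ if (e : ℤ) ∣ k then
        (K : ℝ) ^ A * (tau e : ℝ) ^ A' else 0 := by
      intro e _
      split_ifs <;> positivity
    split_ifs with hk0
    · exact Finset.sum_nonneg hnn
    obtain ⟨e, he, hek, hte⟩ := hK k.natAbs (Int.natAbs_pos.mpr hk0)
    have he0 : 0 < e := Nat.pos_of_dvd_of_pos he (Int.natAbs_pos.mpr hk0)
    have heH : (e : ℝ) ≤ H := by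
      -- The exponent `2^(d+1)` was chosen to be at least `d + 1`, so that the bound `H^(d+1)` on
      -- the value forces `e ≤ H`.
      have h1 : (e : ℝ) ^ (d + 1) ≤ H ^ (d + 1) := by
        calc (e : ℝ) ^ (d + 1) ≤ (e : ℝ) ^ 2 ^ (d + 1) :=
              pow_le_pow_right₀ (by exact_mod_cast he0) Nat.lt_two_pow_self.le
          _ ≤ (k.natAbs : ℝ) := by exact_mod_cast hek
          _ = |(k : ℝ)| := by rw [Nat.cast_natAbs, Int.cast_abs]
          _ ≤ _ := hbp
      exact le_of_pow_le_pow_left₀ (by omega) hH0 h1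
    have hmem : e ∈ Finset.Icc 1 ⌊H⌋₊ := Finset.mem_Icc.mpr ⟨he0, Nat.le_floor heH⟩
    refine le_trans ?_ (Finset.single_le_sum hnn hmem)
    rw [if_pos (Int.natCast_dvd.mpr he), hA', pow_mul, ← mul_pow]
    exact pow_le_pow_left₀ (by positivity) (by exact_mod_cast hte) A
  refine (Finset.sum_le_sum hpt).trans ?_
  rw [Finset.sum_comm]
  have hinner : ∀ e ∈ Finset.Icc 1 ⌊H⌋₊, (∑ p ∈ I ×ˢ I,
      if (e : ℤ) ∣ p.1 * α + p.2 * β + u then (K : ℝ) ^ A * (tau e : ℝ) ^ A' else 0) ≤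
      (K : ℝ) ^ A * 9 * H ^ 2 * ((tau e : ℝ) ^ A' / e) := by
    intro e he
    rw [Finset.mem_Icc] at he
    rw [← Finset.sum_filter, Finset.sum_const, nsmul_eq_mul]
    have := card_dvd_linear_le hH u hc he.1 ((Nat.cast_le.mpr he.2).trans (Nat.floor_le hH0))
    calc _ ≤ (9 * H ^ 2 / e) * ((K : ℝ) ^ A * (tau e : ℝ) ^ A') := by gcongr
      _ = _ := by ring
  refine (Finset.sum_le_sum hinner).trans ?_
  rw [← Finset.mul_sum]
  have h1 : (1 : ℝ) ≤ (⌊H⌋₊ : ℝ) := by exact_mod_cast Nat.le_floor (by simpa using hH1)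
  have hlog : Real.log ⌊H⌋₊ ≤ Real.log H :=
    Real.log_le_log (by linarith) (Nat.floor_le hH0)
  have hlog0 : 0 ≤ Real.log ⌊H⌋₊ := Real.log_nonneg h1
  calc _ ≤ (K : ℝ) ^ A * 9 * H ^ 2 * (1 + Real.log ⌊H⌋₊) ^ 2 ^ A' := by
        gcongr
        exact sum_tau_pow_div_le A' ⌊H⌋₊
    _ ≤ (K : ℝ) ^ A * 9 * H ^ 2 * (1 + Real.log H) ^ 2 ^ A' := by gcongr
    _ ≤ _ := by
      gcongr
      linarith

/-! ### Binary forms as coefficient vectors. -/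

/-- The binary form `∑ c_j t₁^j t₂^(d-j)`. -/
noncomputable def binaryForm (d : ℕ) (c : Fin (d + 1) → ℤ) : MvPolynomial (Fin 2) ℤ :=
  ∑ j : Fin (d + 1),
    MvPolynomial.monomial (Finsupp.single 0 (j : ℕ) + Finsupp.single 1 (d - j)) (c j)

theorem binaryForm_isHomogeneous (d : ℕ) (c : Fin (d + 1) → ℤ) :
    (binaryForm d c).IsHomogeneous d := by
  refine MvPolynomial.IsHomogeneous.sum _ _ _ fun j _ =>
    MvPolynomial.isHomogeneous_monomial _ ?_
  have := j.2
  simp only [map_add, Finsupp.degree_single]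
  omega

theorem coeff_binaryForm (d : ℕ) (c : Fin (d + 1) → ℤ) (k : Fin (d + 1)) :
    (binaryForm d c).coeff (Finsupp.single 0 (k : ℕ) + Finsupp.single 1 (d - k)) = c k := by
  classical
  rw [binaryForm, MvPolynomial.coeff_sum, Finset.sum_eq_single k]
  · simp
  · intro j _ hjk
    rw [MvPolynomial.coeff_monomial, if_neg]
    intro h
    have := DFunLike.congr_fun h 0
    simp at this
    exact hjk (Fin.ext this)
  · simp

theorem eq_single_add_single {d : ℕ} {m : Fin 2 →₀ ℕ} (hm : m.degree = d) :
    m = Finsupp.single 0 (m 0) + Finsupp.single 1 (d - m 0) ∧ m 0 ≤ d := by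
  have hs : m 0 + m 1 = d := by
    rw [← hm, Finsupp.degree_eq_sum, Fin.sum_univ_two]
  refine ⟨?_, by omega⟩
  ext i
  fin_cases i
  · simp
  · simp
    omega

theorem binaryForm_coeff {d : ℕ} {F : MvPolynomial (Fin 2) ℤ} (hF : F.IsHomogeneous d) :
    binaryForm d (fun j => F.coeff (Finsupp.single 0 (j : ℕ) + Finsupp.single 1 (d - j))) = F := by
  ext m
  by_cases hm : m.degree = d
  · obtain ⟨h1, h2⟩ := eq_single_add_single hm
    rw [h1]
    exact coeff_binaryForm d _ ⟨m 0, by omega⟩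
  · rw [(binaryForm_isHomogeneous d _).coeff_eq_zero hm, hF.coeff_eq_zero hm]

theorem formHeight_binaryForm_le {d h : ℕ} {c : Fin (d + 1) → ℤ}
    (hc : ∀ j, (c j).natAbs ≤ h) : formHeight (binaryForm d c) ≤ h := by
  refine Finset.sup_le fun m _ => ?_
  by_cases hm : m.degree = d
  · obtain ⟨h1, h2⟩ := eq_single_add_single hm
    rw [h1]
    exact (coeff_binaryForm d c ⟨m 0, by omega⟩).symm ▸ hc _
  · rw [(binaryForm_isHomogeneous d _).coeff_eq_zero hm]
    simp

theorem sum_formsOfHeight {M : Type*} [AddCommMonoid M] (d : ℕ) {H : ℝ} (hH : 0 ≤ H)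
    (Φ : MvPolynomial (Fin 2) ℤ → M) :
    ∑ F ∈ formsOfHeight d H, Φ F =
      ∑ c ∈ Fintype.piFinset fun _ : Fin (d + 1) => Finset.Icc (-(⌊H⌋₊ : ℤ)) ⌊H⌋₊,
        Φ (binaryForm d c) := by
  refine Finset.sum_nbij' (fun F j => F.coeff (Finsupp.single 0 (j : ℕ) + Finsupp.single 1 (d - j)))
    (binaryForm d) ?_ ?_ ?_ ?_ ?_
  · intro F hF
    have hF' := ((finite_formsOfHeight d H).mem_toFinset.mp hF).2
    have h1 : formHeight F ≤ ⌊H⌋₊ := Nat.le_floor hF'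
    refine Fintype.mem_piFinset.mpr fun j => Finset.mem_Icc.mpr ?_
    have h2 := natAbs_coeff_le_formHeight F
      (Finsupp.single 0 (j : ℕ) + Finsupp.single 1 (d - j))
    constructor <;> omega
  · intro c hc
    refine (finite_formsOfHeight d H).mem_toFinset.mpr ⟨binaryForm_isHomogeneous d c, ?_⟩
    refine le_trans (Nat.cast_le.mpr (formHeight_binaryForm_le (h := ⌊H⌋₊) fun j => ?_))
      (Nat.floor_le hH)
    have := Finset.mem_Icc.mp (Fintype.mem_piFinset.mp hc j)
    omega
  · intro F hF
    exact binaryForm_coeff ((finite_formsOfHeight d H).mem_toFinset.mp hF).1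
  · intro c _
    exact funext fun k => coeff_binaryForm d c k
  · intro F hF
    rw [binaryForm_coeff ((finite_formsOfHeight d H).mem_toFinset.mp hF).1]

/-- Summation over vectors, with the first and the last entry singled out. -/
theorem sum_piFinset_cons_snoc {M : Type*} [AddCommMonoid M] (e : ℕ) (I : Finset ℤ)
    (Ψ : (Fin (e + 2) → ℤ) → M) :
    ∑ c ∈ Fintype.piFinset fun _ : Fin (e + 2) => I, Ψ c =
      ∑ c ∈ Fintype.piFinset fun _ : Fin e => I, ∑ p ∈ I ×ˢ I,
        Ψ (Fin.cons p.1 (Fin.snoc c p.2 : Fin (e + 1) → ℤ)) := by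
  rw [← Finset.sum_product']
  refine Finset.sum_nbij'
    (fun c => (fun j : Fin e => c j.castSucc.succ, (c 0, c (Fin.last e).succ)))
    (fun q => (Fin.cons q.2.1 (Fin.snoc q.1 q.2.2 : Fin (e + 1) → ℤ) : Fin (e + 2) → ℤ))
    ?_ ?_ ?_ ?_ ?_
  · intro c hc
    simp only [Fintype.mem_piFinset, Finset.mem_product] at hc ⊢
    exact ⟨fun _ => hc _, hc _, hc _⟩
  · rintro ⟨c, a, b⟩ hc
    simp only [Fintype.mem_piFinset, Finset.mem_product] at hc ⊢
    intro j
    refine Fin.cases (by simpa using hc.2.1) (fun j => ?_) j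
    rw [Fin.cons_succ]
    refine Fin.lastCases (by simpa using hc.2.2) (fun j => ?_) j
    simpa using hc.1 j
  · intro c _
    funext j
    refine Fin.cases (by simp) (fun j => ?_) j
    rw [Fin.cons_succ]
    exact Fin.lastCases (by simp) (fun j => by simp) j
  · rintro ⟨c, a, b⟩ _
    simp
  · intro c _
    congr 1
    funext j
    refine Fin.cases (by simp) (fun j => ?_) j
    rw [Fin.cons_succ]
    exact Fin.lastCases (by simp) (fun j => by simp) j

theorem eval_binaryForm (d : ℕ) (c : Fin (d + 1) → ℤ) (n : ℤ × ℤ) :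
    MvPolynomial.eval ![n.1, n.2] (binaryForm d c) =
      ∑ j : Fin (d + 1), c j * (n.1 ^ (j : ℕ) * n.2 ^ (d - j)) := by
  rw [binaryForm, map_sum]
  refine Finset.sum_congr rfl fun j _ => ?_
  rw [MvPolynomial.eval_monomial, Finsupp.prod_add_index' (by simp) (by simp [pow_add])]
  simp

/-- The part of a binary form of degree `e + 1` that comes from its middle coefficients. -/
def middlePart (e : ℕ) (c : Fin e → ℤ) (n : ℤ × ℤ) : ℤ :=
  ∑ j : Fin e, c j * (n.1 ^ ((j : ℕ) + 1) * n.2 ^ (e - j))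

theorem eval_binaryForm_cons_snoc (e : ℕ) (c : Fin e → ℤ) (a b : ℤ) (n : ℤ × ℤ) :
    MvPolynomial.eval ![n.1, n.2]
        (binaryForm (e + 1) (Fin.cons a (Fin.snoc c b : Fin (e + 1) → ℤ))) =
      a * n.2 ^ (e + 1) + b * n.1 ^ (e + 1) + middlePart e c n := by
  rw [eval_binaryForm, Fin.sum_univ_succ, Fin.sum_univ_castSucc, middlePart]
  simp [Nat.add_sub_add_right]
  ring

theorem abs_eval_binaryForm_le {d h : ℕ} {c : Fin (d + 1) → ℤ} {H x : ℝ} (hH : (h : ℝ) ≤ H)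
    (hc : c ∈ Fintype.piFinset fun _ : Fin (d + 1) => Finset.Icc (-(h : ℤ)) h) {n : ℤ × ℤ}
    (h1 : |(n.1 : ℝ)| ≤ x) (h2 : |(n.2 : ℝ)| ≤ x) :
    |((MvPolynomial.eval ![n.1, n.2] (binaryForm d c) : ℤ) : ℝ)| ≤
      (1 + (d : ℝ)) * x ^ d * H := by
  have hx : 0 ≤ x := (abs_nonneg _).trans h1
  rw [eval_binaryForm]
  push_cast
  refine (Finset.abs_sum_le_sum_abs _ _).trans ?_
  have : ∀ j ∈ (Finset.univ : Finset (Fin (d + 1))),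
      |(c j : ℝ) * ((n.1 : ℝ) ^ (j : ℕ) * (n.2 : ℝ) ^ (d - j : ℕ))| ≤ H * x ^ d := by
    intro j _
    have hcj := Finset.mem_Icc.mp (Fintype.mem_piFinset.mp hc j)
    have hcj' : |(c j : ℝ)| ≤ H := by
      refine le_trans ?_ hH
      exact_mod_cast abs_le.mpr hcj
    rw [abs_mul, abs_mul, abs_pow, abs_pow]
    have hj : (j : ℕ) + (d - j) = d := by have := j.2; omega
    calc _ ≤ H * (x ^ (j : ℕ) * x ^ (d - j : ℕ)) := by gcongr; linarith [abs_nonneg (c j : ℝ)]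
      _ = _ := by rw [← pow_add, hj]
  refine (Finset.sum_le_sum this).trans (le_of_eq ?_)
  rw [Finset.sum_const, Finset.card_univ, Fintype.card_fin, nsmul_eq_mul]
  push_cast
  ring

/-! ### First and second moments of divisor-bounded functions. -/

theorem sum_norm_Icc_le {f : ℤ → ℂ} {B : ℝ} {c : ℕ}
    (hf : ∀ n : ℤ, ‖f n‖ ≤ B * (if n = 0 then 1 else (tau n.natAbs : ℝ) ^ c)) (Y : ℕ) :
    ∑ k ∈ Finset.Icc (-(Y : ℤ)) Y, ‖f k‖ ≤
      B + 2 * B * ∑ n ∈ Finset.Icc 1 Y, (tau n : ℝ) ^ c := by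
  induction Y with
  | zero => simpa using hf 0
  | succ Y ih =>
    have h1 : Finset.Icc (-((Y + 1 : ℕ) : ℤ)) ((Y + 1 : ℕ) : ℤ) =
        insert ((Y + 1 : ℕ) : ℤ) (insert (-((Y + 1 : ℕ) : ℤ)) (Finset.Icc (-(Y : ℤ)) Y)) := by
      ext k
      simp only [Finset.mem_insert, Finset.mem_Icc]
      omega
    rw [h1, Finset.sum_insert (by simp only [Finset.mem_insert, Finset.mem_Icc]; omega),
      Finset.sum_insert (by simp only [Finset.mem_Icc]; omega),
      Finset.sum_Icc_succ_top (by omega)]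
    have h2 := hf ((Y + 1 : ℕ) : ℤ)
    have h3 := hf (-((Y + 1 : ℕ) : ℤ))
    rw [if_neg (by omega)] at h2 h3
    rw [Int.natAbs_natCast] at h2
    rw [Int.natAbs_neg, Int.natAbs_natCast] at h3
    linarith

theorem sum_norm_Icc_ceil_floor_le {f : ℤ → ℂ} {B : ℝ} {c : ℕ} (hB : 0 ≤ B)
    (hf : ∀ n : ℤ, ‖f n‖ ≤ B * (if n = 0 then 1 else (tau n.natAbs : ℝ) ^ c)) {T : ℝ}
    (hT : 1 ≤ T) :
    ∑ k ∈ Finset.Icc ⌈-T⌉ ⌊T⌋, ‖f k‖ ≤ 3 * B * T * (1 + Real.log T) ^ 2 ^ c := by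
  have hT0 : 0 ≤ T := zero_le_one.trans hT
  have hfl : ⌊T⌋ = (⌊T⌋₊ : ℤ) := (Int.natCast_floor_eq_floor hT0).symm
  rw [Int.ceil_neg, hfl]
  refine (sum_norm_Icc_le hf _).trans ?_
  have h1 : (1 : ℝ) ≤ (⌊T⌋₊ : ℝ) := by exact_mod_cast Nat.le_floor (by simpa using hT)
  have hlog : Real.log ⌊T⌋₊ ≤ Real.log T :=
    Real.log_le_log (by linarith) (Nat.floor_le hT0)
  have hlog0 : 0 ≤ Real.log ⌊T⌋₊ := Real.log_nonneg h1
  have h2 : ∑ n ∈ Finset.Icc 1 ⌊T⌋₊, (tau n : ℝ) ^ c ≤ T * (1 + Real.log T) ^ 2 ^ c := by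
    refine (sum_tau_pow_le c _).trans ?_
    gcongr
    exact Nat.floor_le hT0
  have h3 : 1 ≤ T * (1 + Real.log T) ^ 2 ^ c :=
    one_le_mul_of_one_le_of_one_le hT (one_le_pow₀ (by linarith))
  nlinarith

/-- The crude bound `τ(n)^(2A) ≪ n (log n)^M`, followed by a square root. It is applied to the gcd
of a point; losing `√x` is affordable because degenerate pairs save a full `x`. -/
theorem tau_pow_le_sqrt {A n : ℕ} {x H : ℝ} (hn : 0 < n) (hnx : (n : ℝ) ≤ x) (hxH : x ≤ H) :
    (tau n : ℝ) ^ A ≤ √x * (1 + Real.log H) ^ 2 ^ (2 * A) := by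
  have hn1 : (1 : ℝ) ≤ n := by exact_mod_cast hn
  have hlog : Real.log n ≤ Real.log H := Real.log_le_log (by linarith) (hnx.trans hxH)
  have hlog0 : 0 ≤ Real.log n := Real.log_nonneg hn1
  have hL : 1 ≤ (1 + Real.log H) ^ 2 ^ (2 * A) := one_le_pow₀ (by linarith)
  have h1 : ((tau n : ℝ) ^ A) ^ 2 ≤ (√x * (1 + Real.log H) ^ 2 ^ (2 * A)) ^ 2 := by
    rw [← pow_mul, mul_pow, Real.sq_sqrt (by linarith), mul_comm A 2]
    refine (tau_pow_le_mul_log (2 * A) n hn).trans ?_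
    have h2 : (1 + Real.log n) ^ 2 ^ (2 * A) ≤ (1 + Real.log H) ^ 2 ^ (2 * A) := by gcongr
    have h3 : (1 + Real.log H) ^ 2 ^ (2 * A) ≤ ((1 + Real.log H) ^ 2 ^ (2 * A)) ^ 2 := by
      nlinarith
    calc _ ≤ x * (1 + Real.log H) ^ 2 ^ (2 * A) := by gcongr; linarith
      _ ≤ _ := by gcongr; linarith
  exact le_of_pow_le_pow_left₀ two_ne_zero (by positivity) h1

theorem card_Icc_neg_le {h : ℕ} {H : ℝ} (hH : (h : ℝ) ≤ H) (hH1 : 1 ≤ H) :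
    ((Finset.Icc (-(h : ℤ)) h).card : ℝ) ≤ 3 * H := by
  have : (Finset.Icc (-(h : ℤ)) h).card = 2 * h + 1 := by
    rw [Int.card_Icc]
    omega
  rw [this]
  push_cast
  linarith

/-- The second moment of a divisor-bounded function along the linear form
with coefficients the `d`-th powers of the coordinates of `n`. -/
theorem exists_sum_norm_sq_linear_le {B : ℝ} (hB : 0 < B) (c d D : ℕ) :
    ∃ K : ℝ, 0 < K ∧ ∃ M : ℕ, ∀ f : ℤ → ℂ,
      (∀ n : ℤ, ‖f n‖ ≤ B * (if n = 0 then 1 else (tau n.natAbs : ℝ) ^ c)) →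
      ∀ (H x : ℝ) (h : ℕ) (n : ℤ × ℤ) (u : ℤ), 1 ≤ x → x ≤ H → (h : ℝ) ≤ H → n ≠ 0 →
      |(n.1 : ℝ)| ≤ x → |(n.2 : ℝ)| ≤ x → (Int.gcd n.1 n.2 : ℤ) ^ d ∣ u →
      (∀ a ∈ Finset.Icc (-(h : ℤ)) h, ∀ b ∈ Finset.Icc (-(h : ℤ)) h,
        |((a * n.2 ^ d + b * n.1 ^ d + u : ℤ) : ℝ)| ≤ H ^ (D + 1)) →
      ∑ p ∈ Finset.Icc (-(h : ℤ)) h ×ˢ Finset.Icc (-(h : ℤ)) h,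
        ‖f (p.1 * n.2 ^ d + p.2 * n.1 ^ d + u)‖ ^ 2 ≤
        K * H ^ 2 * √x * (1 + Real.log H) ^ M := by
  classical
  obtain ⟨K₀, hK₀, M₀, hlin⟩ := exists_sum_tau_linear_le (2 * c) D
  set A := d * (2 * c) with hA
  refine ⟨B ^ 2 * (9 + K₀), by positivity, 2 ^ (2 * A) + M₀,
    fun f hf H x h n u hx1 hxH hhH hn hn1 hn2 hgu hb => ?_⟩
  have hH1 : 1 ≤ H := hx1.trans hxH
  have hL : 0 ≤ Real.log H := Real.log_nonneg hH1
  have hgpos : 0 < Int.gcd n.1 n.2 := by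
    rw [Int.gcd_pos_iff]
    by_contra! hcon
    exact hn (Prod.ext hcon.1 hcon.2)
  obtain ⟨n₁, n₂, hcop, hn₁, hn₂⟩ := Int.exists_gcd_one hgpos
  set g := Int.gcd n.1 n.2 with hg
  obtain ⟨u', rfl⟩ := hgu
  have hgx : (g : ℝ) ≤ x := by
    rcases ne_or_eq n.1 0 with h0 | h0
    · have h1 : (g : ℤ) ≤ |n.1| := Int.le_of_dvd (abs_pos.mpr h0)
        ((dvd_abs _ _).mpr (Int.gcd_dvd_left _ _))
      have h2 : ((g : ℤ) : ℝ) ≤ ((|n.1| : ℤ) : ℝ) := Int.cast_le.mpr h1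
      push_cast at h2
      linarith
    · have h0' : n.2 ≠ 0 := fun h' => hn (Prod.ext h0 h')
      have h1 : (g : ℤ) ≤ |n.2| := Int.le_of_dvd (abs_pos.mpr h0')
        ((dvd_abs _ _).mpr (Int.gcd_dvd_right _ _))
      have h2 : ((g : ℤ) : ℝ) ≤ ((|n.2| : ℤ) : ℝ) := Int.cast_le.mpr h1
      push_cast at h2
      linarith
  -- Dividing by `g^d` leaves a linear form with coprime coefficients `n₂^d`, `n₁^d`, as the divisor
  -- moment bound requires.
  have hfac : ∀ a b : ℤ, a * n.2 ^ d + b * n.1 ^ d + (g : ℤ) ^ d * u' =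
      (g : ℤ) ^ d * (a * n₂ ^ d + b * n₁ ^ d + u') := by
    intro a b
    rw [hn₁, hn₂]
    ring
  have hgd1 : (1 : ℝ) ≤ (g : ℝ) ^ d := one_le_pow₀ (by exact_mod_cast hgpos)
  have hcop' : IsCoprime (n₂ ^ d) (n₁ ^ d) := (Int.isCoprime_iff_gcd_eq_one.mpr hcop).symm.pow
  have hb' : ∀ a ∈ Finset.Icc (-(h : ℤ)) h, ∀ b ∈ Finset.Icc (-(h : ℤ)) h,
      |((a * n₂ ^ d + b * n₁ ^ d + u' : ℤ) : ℝ)| ≤ H ^ (D + 1) := by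
    intro a ha b hb''
    refine le_trans ?_ (hb a ha b hb'')
    rw [hfac, Int.cast_mul, abs_mul]
    refine le_mul_of_one_le_left (abs_nonneg _) ?_
    push_cast
    rw [abs_of_nonneg (by positivity)]
    exact hgd1
  have hmain := hlin H h _ _ u' hH1 hhH hcop' hb'
  set I := Finset.Icc (-(h : ℤ)) h with hI
  set Q := √x * (1 + Real.log H) ^ 2 ^ (2 * A) with hQ
  have hQ1 : 1 ≤ Q :=
    one_le_mul_of_one_le_of_one_le (Real.one_le_sqrt.mpr hx1) (one_le_pow₀ (by linarith))
  -- The added `1` accounts for the points where the form vanishes, at which only `‖f 0‖ ≤ B` is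
  -- available.
  have hpt : ∀ p ∈ I ×ˢ I, ‖f (p.1 * n.2 ^ d + p.2 * n.1 ^ d + (g : ℤ) ^ d * u')‖ ^ 2 ≤
      B ^ 2 * Q * (1 + if p.1 * n₂ ^ d + p.2 * n₁ ^ d + u' = 0 then (0 : ℝ)
        else (tau (p.1 * n₂ ^ d + p.2 * n₁ ^ d + u').natAbs : ℝ) ^ (2 * c)) := by
    intro p _
    rw [hfac]
    set k := p.1 * n₂ ^ d + p.2 * n₁ ^ d + u' with hk
    have h1 := pow_le_pow_left₀ (norm_nonneg _) (hf ((g : ℤ) ^ d * k)) 2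
    refine h1.trans ?_
    split_ifs with h2 h3 h3
    · nlinarith [sq_nonneg B]
    · have : (0 : ℝ) ≤ (tau k.natAbs : ℝ) ^ (2 * c) := by positivity
      nlinarith [sq_nonneg B, mul_nonneg (mul_nonneg (sq_nonneg B) (zero_le_one.trans hQ1)) this]
    · exact absurd (by rw [h3, mul_zero]) h2
    · rw [mul_pow, ← pow_mul, Int.natAbs_mul, Int.natAbs_pow, Int.natAbs_natCast, mul_comm c 2,
        mul_assoc]
      have h4 : (tau (g ^ d * k.natAbs) : ℝ) ≤ (tau g : ℝ) ^ d * tau k.natAbs := by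
        exact_mod_cast (tau_mul_le _ _).trans (Nat.mul_le_mul_right _ (tau_pow_le g d))
      have h5 : (tau (g ^ d * k.natAbs) : ℝ) ^ (2 * c) ≤ Q * (tau k.natAbs : ℝ) ^ (2 * c) := by
        refine (pow_le_pow_left₀ (by positivity) h4 _).trans ?_
        rw [mul_pow, ← pow_mul]
        gcongr
        exact tau_pow_le_sqrt hgpos hgx hxH
      have h6 : 0 ≤ Q := zero_le_one.trans hQ1
      gcongr
      linarith
  refine (Finset.sum_le_sum hpt).trans ?_
  rw [← Finset.mul_sum, Finset.sum_add_distrib, Finset.sum_const, nsmul_eq_mul, mul_one,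
    Finset.card_product, Nat.cast_mul]
  have hcard := card_Icc_neg_le hhH hH1
  rw [← hI] at hcard
  have hLM : 1 ≤ (1 + Real.log H) ^ M₀ := one_le_pow₀ (by linarith)
  have hI2 : (I.card : ℝ) * I.card ≤ (3 * H) * (3 * H) * (1 + Real.log H) ^ M₀ :=
    (mul_le_mul hcard hcard (Nat.cast_nonneg _) (by linarith)).trans
      (le_mul_of_one_le_right (by nlinarith) hLM)
  have hQ0 : 0 ≤ B ^ 2 * Q := mul_nonneg (sq_nonneg B) (zero_le_one.trans hQ1)
  refine (mul_le_mul_of_nonneg_left (add_le_add hI2 hmain) hQ0).trans (le_of_eq ?_)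
  rw [hQ, pow_add]
  ring

/-! ### Points of the box, dispersion, and independent pairs. -/

theorem card_Icc_ceil_floor_le {x : ℝ} (hx : 1 ≤ x) :
    ((Finset.Icc ⌈-x⌉ ⌊x⌋).card : ℝ) ≤ 3 * x := by
  have hx0 : 0 ≤ x := zero_le_one.trans hx
  rw [Int.ceil_neg, ← Int.natCast_floor_eq_floor hx0]
  exact card_Icc_neg_le (Nat.floor_le hx0) hx

theorem mem_intBox {x : ℝ} {n : ℤ × ℤ} :
    n ∈ intBox x ↔ |(n.1 : ℝ)| ≤ x ∧ |(n.2 : ℝ)| ≤ x := by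
  simp [intBox, Int.ceil_le, Int.le_floor, abs_le]

/-- Few points of a box are degenerate with respect to a given nonzero point. -/
theorem card_degenerate_le {x : ℝ} (hx : 1 ≤ x) {d : ℕ} (hd : d ≠ 0) {n : ℤ × ℤ} (hn : n ≠ 0) :
    (((intBox x).filter fun m => n.2 ^ d * m.1 ^ d - n.1 ^ d * m.2 ^ d = 0).card : ℝ) ≤
      6 * x := by
  classical
  -- Equality of `d`-th powers gives equality up to sign. So one coordinate of `m`, suitably chosen,
  -- determines the other up to sign.
  have habs : ∀ m : ℤ × ℤ, n.2 ^ d * m.1 ^ d - n.1 ^ d * m.2 ^ d = 0 →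
      |n.2| * |m.1| = |n.1| * |m.2| := by
    intro m hm
    rw [← mul_pow, ← mul_pow, sub_eq_zero] at hm
    have h1 := congrArg abs hm
    rw [abs_pow, abs_pow] at h1
    have h2 := (pow_left_inj₀ (abs_nonneg _) (abs_nonneg _) hd).mp h1
    rwa [abs_mul, abs_mul] at h2
  have hIcc := card_Icc_ceil_floor_le hx
  have hfin : ∀ {S : Finset (ℤ × ℤ)}, S.card ≤ 2 * (Finset.Icc ⌈-x⌉ ⌊x⌋).card →
      (S.card : ℝ) ≤ 6 * x := by
    intro S hS
    have : (S.card : ℝ) ≤ 2 * ((Finset.Icc ⌈-x⌉ ⌊x⌋).card : ℝ) := by exact_mod_cast hS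
    linarith
  refine hfin ?_
  rcases ne_or_eq n.1 0 with h0 | h0
  · refine Finset.card_le_mul_card_image_of_maps_to (f := Prod.fst) (fun m hm =>
      (Finset.mem_product.mp (Finset.mem_filter.mp hm).1).1) 2 fun b _ => ?_
    rcases Finset.eq_empty_or_nonempty (((intBox x).filter fun m =>
      n.2 ^ d * m.1 ^ d - n.1 ^ d * m.2 ^ d = 0).filter fun m => m.1 = b) with he | ⟨m, hm⟩
    · exact (Finset.card_eq_zero.mpr he).trans_le (Nat.zero_le _)
    · refine (Finset.card_le_card (t := {(b, m.2), (b, -m.2)}) fun m' hm' => ?_).trans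
        Finset.card_le_two
      obtain ⟨h1, h2⟩ := Finset.mem_filter.mp hm
      obtain ⟨h1', h2'⟩ := Finset.mem_filter.mp hm'
      have h3 := habs m (Finset.mem_filter.mp h1).2
      have h3' := habs m' (Finset.mem_filter.mp h1').2
      rw [h2] at h3
      rw [h2', h3] at h3'
      have h4 := mul_left_cancel₀ (abs_ne_zero.mpr h0) h3'
      rw [Finset.mem_insert, Finset.mem_singleton]
      rcases abs_eq_abs.mp h4 with h5 | h5
      · exact Or.inl (Prod.ext h2' h5.symm)
      · exact Or.inr (Prod.ext h2' (by rw [h5]; simp))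
  · have h0' : n.2 ≠ 0 := fun h' => hn (Prod.ext h0 h')
    refine Finset.card_le_mul_card_image_of_maps_to (f := Prod.snd) (fun m hm =>
      (Finset.mem_product.mp (Finset.mem_filter.mp hm).1).2) 2 fun b _ => ?_
    -- Only one point is possible here; it is listed twice to match the factor `2` of the other
    -- case.
    refine (Finset.card_le_card (t := {(0, b), (0, b)}) fun m' hm' => ?_).trans
      Finset.card_le_two
    obtain ⟨h1', h2'⟩ := Finset.mem_filter.mp hm'
    have h3' := habs m' (Finset.mem_filter.mp h1').2
    rw [h0, abs_zero, zero_mul] at h3'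
    have h4 := (mul_eq_zero.mp h3').resolve_left (abs_ne_zero.mpr h0')
    rw [Finset.mem_insert]
    exact Or.inl (Prod.ext (abs_eq_zero.mp h4) h2')

theorem discrepancy_le_sqrt_maxSqDiscrepancy (f : ℤ → ℂ) {T Q : ℝ} {q : ℕ} (hq : 0 < q)
    (hqQ : (q : ℝ) ≤ Q) : discrepancy f T q ≤ √(maxSqDiscrepancy f T Q) := by
  refine Real.le_sqrt_of_sq_le ?_
  -- Finiteness makes the supremum bounded; an unbounded real supremum would default to `0`.
  have hfin : Finite {q : ℕ // 1 ≤ q ∧ (q : ℝ) ≤ Q} :=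
    ((Set.finite_Iic ⌊Q⌋₊).subset fun q hq => Nat.le_floor hq.2).to_subtype
  exact le_ciSup (f := fun q : {q : ℕ // 1 ≤ q ∧ (q : ℝ) ≤ Q} => discrepancy f T q ^ 2)
    (Set.finite_range _).bddAbove ⟨q, hq, hqQ⟩

theorem maxSqDiscrepancy_nonneg (f : ℤ → ℂ) (T Q : ℝ) : 0 ≤ maxSqDiscrepancy f T Q :=
  Real.iSup_nonneg fun _ => sq_nonneg _

/-- Opening the square and taking absolute values only after the sum over `S` keeps the cancellation
in that sum. -/
theorem sum_norm_sum_sq_le {ι κ : Type*} (S : Finset ι) (R : Finset κ) (G : ι → κ → ℂ) :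
    ∑ F ∈ S, ‖∑ n ∈ R, G F n‖ ^ 2 ≤
      ∑ n ∈ R, ∑ m ∈ R, ‖∑ F ∈ S, G F n * starRingEnd ℂ (G F m)‖ := by
  have h1 : ((∑ F ∈ S, ‖∑ n ∈ R, G F n‖ ^ 2 : ℝ) : ℂ) =
      ∑ n ∈ R, ∑ m ∈ R, ∑ F ∈ S, G F n * starRingEnd ℂ (G F m) := by
    push_cast
    have h2 : ∀ n ∈ R, ∑ m ∈ R, ∑ F ∈ S, G F n * starRingEnd ℂ (G F m) =
        ∑ F ∈ S, ∑ m ∈ R, G F n * starRingEnd ℂ (G F m) := fun n _ => Finset.sum_comm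
    rw [Finset.sum_congr rfl h2, Finset.sum_comm]
    refine Finset.sum_congr rfl fun F _ => ?_
    rw [← Complex.mul_conj', map_sum, Finset.sum_mul_sum]
  have h3 : (0 : ℝ) ≤ ∑ F ∈ S, ‖∑ n ∈ R, G F n‖ ^ 2 :=
    Finset.sum_nonneg fun _ _ => by positivity
  calc ∑ F ∈ S, ‖∑ n ∈ R, G F n‖ ^ 2 = ‖((∑ F ∈ S, ‖∑ n ∈ R, G F n‖ ^ 2 : ℝ) : ℂ)‖ := by
        rw [Complex.norm_real, Real.norm_of_nonneg h3]
    _ ≤ _ := by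
        rw [h1]
        exact (norm_sum_le _ _).trans (Finset.sum_le_sum fun _ _ => norm_sum_le _ _)

theorem sum_formsOfHeight_eval {M : Type*} [AddCommMonoid M] (e : ℕ) {H : ℝ} (hH : 0 ≤ H)
    (n m : ℤ × ℤ) (Φ : ℤ → ℤ → M) :
    ∑ F ∈ formsOfHeight (e + 1) H,
        Φ (MvPolynomial.eval ![n.1, n.2] F) (MvPolynomial.eval ![m.1, m.2] F) =
      ∑ c ∈ Fintype.piFinset fun _ : Fin e => Finset.Icc (-(⌊H⌋₊ : ℤ)) ⌊H⌋₊,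
        ∑ p ∈ Finset.Icc (-(⌊H⌋₊ : ℤ)) ⌊H⌋₊ ×ˢ Finset.Icc (-(⌊H⌋₊ : ℤ)) ⌊H⌋₊,
          Φ (p.1 * n.2 ^ (e + 1) + p.2 * n.1 ^ (e + 1) + middlePart e c n)
            (p.1 * m.2 ^ (e + 1) + p.2 * m.1 ^ (e + 1) + middlePart e c m) := by
  rw [sum_formsOfHeight _ hH, sum_piFinset_cons_snoc]
  simp only [eval_binaryForm_cons_snoc]

theorem abs_form_value_le {e h : ℕ} {c : Fin e → ℤ} {H x : ℝ} (hH : (h : ℝ) ≤ H)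
    (hc : c ∈ Fintype.piFinset fun _ : Fin e => Finset.Icc (-(h : ℤ)) h) {n : ℤ × ℤ}
    (h1 : |(n.1 : ℝ)| ≤ x) (h2 : |(n.2 : ℝ)| ≤ x) :
    ∀ a ∈ Finset.Icc (-(h : ℤ)) h, ∀ b ∈ Finset.Icc (-(h : ℤ)) h,
      |((a * n.2 ^ (e + 1) + b * n.1 ^ (e + 1) + middlePart e c n : ℤ) : ℝ)| ≤
        (1 + ((e + 1 : ℕ) : ℝ)) * x ^ (e + 1) * H := by
  intro a ha b hb
  rw [← eval_binaryForm_cons_snoc]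
  refine abs_eval_binaryForm_le hH (Fintype.mem_piFinset.mpr fun j => ?_) h1 h2
  refine Fin.cases (by simpa using ha) (fun j => ?_) j
  rw [Fin.cons_succ]
  refine Fin.lastCases (by simpa using hb) (fun j => ?_) j
  simpa using Fintype.mem_piFinset.mp hc j

theorem card_piFinset_Icc_le (e : ℕ) {h : ℕ} {H : ℝ} (hH : (h : ℝ) ≤ H) (hH1 : 1 ≤ H) :
    ((Fintype.piFinset fun _ : Fin e => Finset.Icc (-(h : ℤ)) h).card : ℝ) ≤ (3 * H) ^ e := by
  rw [Fintype.card_piFinset_const, Nat.cast_pow]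
  exact pow_le_pow_left₀ (Nat.cast_nonneg _) (card_Icc_neg_le hH hH1) e

/-- The middle coefficients are summed trivially, giving `(3H)^e`. The modulus bound `2x^(2d)` is
the trivial estimate for the determinant. -/
theorem norm_sum_pair_le_of_independent (f : ℤ → ℂ) (e : ℕ) {H x : ℝ} (hH : 1 ≤ H)
    {n m : ℤ × ℤ} (hn : n ∈ intBox x) (hm : m ∈ intBox x)
    (hD : n.2 ^ (e + 1) * m.1 ^ (e + 1) - n.1 ^ (e + 1) * m.2 ^ (e + 1) ≠ 0) :
    ‖∑ F ∈ formsOfHeight (e + 1) H, f (MvPolynomial.eval ![n.1, n.2] F) *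
      starRingEnd ℂ (f (MvPolynomial.eval ![m.1, m.2] F))‖ ≤
      (3 * H) ^ e * ((∑ k ∈ Finset.Icc ⌈-((1 + ((e + 1 : ℕ) : ℝ)) * x ^ (e + 1) * H)⌉
          ⌊(1 + ((e + 1 : ℕ) : ℝ)) * x ^ (e + 1) * H⌋, ‖f k‖) *
        (2 * √(maxSqDiscrepancy f ((1 + ((e + 1 : ℕ) : ℝ)) * x ^ (e + 1) * H)
          (2 * x ^ (2 * (e + 1)))))) := by
  have hH0 : 0 ≤ H := zero_le_one.trans hH
  rw [mem_intBox] at hn hm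
  have hx : 0 ≤ x := (abs_nonneg _).trans hn.1
  rw [sum_formsOfHeight_eval e hH0 n m fun k l => f k * starRingEnd ℂ (f l)]
  refine (norm_sum_le _ _).trans ((Finset.sum_le_card_nsmul _ _ _ fun c hc =>
    norm_sum_mul_conj_le f hD (Real.sqrt_nonneg _)
      (abs_form_value_le (Nat.floor_le hH0) hc hn.1 hn.2)
      (abs_form_value_le (Nat.floor_le hH0) hc hm.1 hm.2) fun q hq hqD =>
        discrepancy_le_sqrt_maxSqDiscrepancy f (Q := 2 * x ^ (2 * (e + 1))) hq ?_).trans ?_)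
  · have h1 : (q : ℝ) ≤ ((n.2 ^ (e + 1) * m.1 ^ (e + 1) - n.1 ^ (e + 1) * m.2 ^ (e + 1)).natAbs
        : ℝ) := by exact_mod_cast hqD
    refine h1.trans ?_
    rw [Nat.cast_natAbs]
    push_cast
    refine (abs_sub _ _).trans ?_
    simp only [abs_mul, abs_pow]
    calc _ ≤ x ^ (e + 1) * x ^ (e + 1) + x ^ (e + 1) * x ^ (e + 1) := by
          gcongr
          exacts [hn.2, hm.1, hn.1, hm.2]
      _ = _ := by ring
  · rw [nsmul_eq_mul]
    refine mul_le_mul_of_nonneg_right (card_piFinset_Icc_le e (Nat.floor_le hH0) hH) ?_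
    exact mul_nonneg (Finset.sum_nonneg fun _ _ => norm_nonneg _) (by positivity)

theorem norm_sum_mul_conj_le_half {ι : Type*} (S : Finset ι) (a b : ι → ℂ) :
    ‖∑ F ∈ S, a F * starRingEnd ℂ (b F)‖ ≤
      (∑ F ∈ S, ‖a F‖ ^ 2 + ∑ F ∈ S, ‖b F‖ ^ 2) / 2 := by
  rw [← Finset.sum_add_distrib, Finset.sum_div]
  refine (norm_sum_le _ _).trans (Finset.sum_le_sum fun F _ => ?_)
  rw [norm_mul, RCLike.norm_conj]
  nlinarith [sq_nonneg (‖a F‖ - ‖b F‖)]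

/-- Homogeneity: every monomial of degree `e + 1` is divisible by this power of the gcd, so the
constant term of the linear form shares the factor of its coefficients. -/
theorem gcd_pow_dvd_middlePart (e : ℕ) (c : Fin e → ℤ) (n : ℤ × ℤ) :
    (Int.gcd n.1 n.2 : ℤ) ^ (e + 1) ∣ middlePart e c n := by
  refine Finset.dvd_sum fun j _ => Dvd.dvd.mul_left ?_ _
  have hj : e + 1 = ((j : ℕ) + 1) + (e - j) := by have := j.2; omega
  rw [hj, pow_add]
  exact mul_dvd_mul (pow_dvd_pow_of_dvd (Int.gcd_dvd_left _ _) _)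
    (pow_dvd_pow_of_dvd (Int.gcd_dvd_right _ _) _)

theorem linear_value_bound_le {e : ℕ} {H x : ℝ} (hH : 2 ≤ H) (hx : 0 ≤ x) (hxH : x ≤ H) :
    (1 + ((e + 1 : ℕ) : ℝ)) * x ^ (e + 1) * H ≤ H ^ (2 * (e + 1) + 1) := by
  have h1 : (1 + ((e + 1 : ℕ) : ℝ)) ≤ H ^ (e + 1) := by
    refine le_trans ?_ (pow_le_pow_left₀ zero_le_two hH _)
    have : e + 1 + 1 ≤ 2 ^ (e + 1) := Nat.lt_two_pow_self
    have h2 : ((e + 1 + 1 : ℕ) : ℝ) ≤ ((2 ^ (e + 1) : ℕ) : ℝ) := by exact_mod_cast this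
    push_cast at h2 ⊢
    linarith
  calc _ ≤ H ^ (e + 1) * H ^ (e + 1) * H := by gcongr
    _ = _ := by ring

/-- The second moment of a divisor-bounded function over the values of forms at a point. -/
theorem exists_sum_norm_sq_eval_le {B : ℝ} (hB : 0 < B) (c e : ℕ) :
    ∃ K : ℝ, 0 < K ∧ ∃ M : ℕ, ∀ f : ℤ → ℂ,
      (∀ n : ℤ, ‖f n‖ ≤ B * (if n = 0 then 1 else (tau n.natAbs : ℝ) ^ c)) →
      ∀ (H x : ℝ) (n : ℤ × ℤ), 2 ≤ H → 1 ≤ x → x ≤ H → n ∈ intBox x → n ≠ 0 →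
      ∑ F ∈ formsOfHeight (e + 1) H, ‖f (MvPolynomial.eval ![n.1, n.2] F)‖ ^ 2 ≤
        K * H ^ (e + 2) * √x * (1 + Real.log H) ^ M := by
  obtain ⟨K, hK, M, hmom⟩ := exists_sum_norm_sq_linear_le hB c (e + 1) (2 * (e + 1))
  refine ⟨3 ^ e * K, by positivity, M, fun f hf H x n hH hx hxH hn hn0 => ?_⟩
  have hH0 : 0 ≤ H := by linarith
  have hL : 0 ≤ Real.log H := Real.log_nonneg (by linarith)
  rw [mem_intBox] at hn
  rw [sum_formsOfHeight_eval e hH0 n n fun k _ => ‖f k‖ ^ 2]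
  refine (Finset.sum_le_card_nsmul _ _ _ fun c hc => hmom f hf H x _ n _ hx hxH
    (Nat.floor_le hH0) hn0 hn.1 hn.2 (gcd_pow_dvd_middlePart e c n) fun a ha b hb =>
      (abs_form_value_le (Nat.floor_le hH0) hc hn.1 hn.2 a ha b hb).trans
        (linear_value_bound_le hH (by linarith) hxH)).trans ?_
  rw [nsmul_eq_mul]
  refine (mul_le_mul_of_nonneg_right (card_piFinset_Icc_le e (Nat.floor_le hH0) (by linarith))
    (by positivity)).trans (le_of_eq ?_)
  ring

/-- The origin needs separate care, being degenerate with every point. Forms of positive degree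
vanish there, so no divisor function enters. -/
theorem sum_norm_sq_eval_zero_le {f : ℤ → ℂ} {B : ℝ} (hf0 : ‖f 0‖ ≤ B) (e : ℕ) {H : ℝ}
    (hH : 1 ≤ H) :
    ∑ F ∈ formsOfHeight (e + 1) H,
      ‖f (MvPolynomial.eval ![(0 : ℤ × ℤ).1, (0 : ℤ × ℤ).2] F)‖ ^ 2 ≤
      B ^ 2 * (3 * H) ^ (e + 2) := by
  have hH0 : 0 ≤ H := by linarith
  rw [sum_formsOfHeight _ hH0]
  refine (Finset.sum_le_card_nsmul _ _ (B ^ 2) fun c _ => ?_).trans ?_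
  · rw [eval_binaryForm, Finset.sum_eq_zero]
    · exact pow_le_pow_left₀ (norm_nonneg _) hf0 2
    · intro j _
      have := j.2
      rcases Nat.eq_zero_or_pos (j : ℕ) with h | h
      · rw [h]
        simp
      · simp [h.ne']
  · rw [nsmul_eq_mul, mul_comm]
    exact mul_le_mul_of_nonneg_left (card_piFinset_Icc_le _ (Nat.floor_le hH0) hH) (sq_nonneg B)

theorem card_intBox_le {x : ℝ} (hx : 1 ≤ x) : ((intBox x).card : ℝ) ≤ 9 * x ^ 2 := by
  rw [intBox, Finset.card_product, Nat.cast_mul]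
  calc _ ≤ (3 * x) * (3 * x) := mul_le_mul (card_Icc_ceil_floor_le hx) (card_Icc_ceil_floor_le hx)
        (Nat.cast_nonneg _) (by linarith)
    _ = _ := by ring

/-! ### Degenerate pairs and the second moment. -/

/-- The contribution of the degenerate pairs of points. -/
theorem exists_sum_degenerate_le {B : ℝ} (hB : 0 < B) (c e : ℕ) :
    ∃ K : ℝ, 0 < K ∧ ∃ M : ℕ, ∀ f : ℤ → ℂ,
      (∀ n : ℤ, ‖f n‖ ≤ B * (if n = 0 then 1 else (tau n.natAbs : ℝ) ^ c)) →
      ∀ H x : ℝ, 2 ≤ H → 1 ≤ x → x ≤ H →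
      ∑ n ∈ intBox x, ∑ m ∈ intBox x,
        (if n.2 ^ (e + 1) * m.1 ^ (e + 1) - n.1 ^ (e + 1) * m.2 ^ (e + 1) = 0 then
          ‖∑ F ∈ formsOfHeight (e + 1) H, f (MvPolynomial.eval ![n.1, n.2] F) *
            starRingEnd ℂ (f (MvPolynomial.eval ![m.1, m.2] F))‖ else 0) ≤
        K * H ^ (e + 2) * (x ^ 3 * √x) * (1 + Real.log H) ^ M := by
  classical
  obtain ⟨K, hK, M, hmom⟩ := exists_sum_norm_sq_eval_le hB c e
  refine ⟨9 * (B ^ 2 * 3 ^ (e + 2)) + 54 * K, by positivity, M, fun f hf H x hH hx hxH => ?_⟩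
  have hL : 0 ≤ Real.log H := Real.log_nonneg (by linarith)
  set G : ℤ × ℤ → ℝ := fun n =>
    ∑ F ∈ formsOfHeight (e + 1) H, ‖f (MvPolynomial.eval ![n.1, n.2] F)‖ ^ 2 with hG
  have hG0 : ∀ n, 0 ≤ G n := fun n => Finset.sum_nonneg fun _ _ => by positivity
  have hpair : ∀ n ∈ intBox x, ∀ m ∈ intBox x,
      (if n.2 ^ (e + 1) * m.1 ^ (e + 1) - n.1 ^ (e + 1) * m.2 ^ (e + 1) = 0 then
          ‖∑ F ∈ formsOfHeight (e + 1) H, f (MvPolynomial.eval ![n.1, n.2] F) *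
            starRingEnd ℂ (f (MvPolynomial.eval ![m.1, m.2] F))‖ else 0) ≤
      (if n.2 ^ (e + 1) * m.1 ^ (e + 1) - n.1 ^ (e + 1) * m.2 ^ (e + 1) = 0 then G n / 2 else 0) +
      (if m.2 ^ (e + 1) * n.1 ^ (e + 1) - m.1 ^ (e + 1) * n.2 ^ (e + 1) = 0 then G m / 2
        else 0) := by
    intro n _ m _
    have hsymm : n.2 ^ (e + 1) * m.1 ^ (e + 1) - n.1 ^ (e + 1) * m.2 ^ (e + 1) = 0 ↔
        m.2 ^ (e + 1) * n.1 ^ (e + 1) - m.1 ^ (e + 1) * n.2 ^ (e + 1) = 0 := by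
      constructor <;> intro h <;> linarith
    by_cases hD : n.2 ^ (e + 1) * m.1 ^ (e + 1) - n.1 ^ (e + 1) * m.2 ^ (e + 1) = 0
    · rw [if_pos hD, if_pos hD, if_pos (hsymm.mp hD), ← add_div]
      exact norm_sum_mul_conj_le_half _ _ _
    · rw [if_neg hD, if_neg hD, if_neg (fun h => hD (hsymm.mpr h)), add_zero]
  -- The origin pairs with all `9x²` points but has a moment free of logarithms and of `√x`; every
  -- other point pairs with at most `6x`.
  have hone : ∀ n ∈ intBox x, ∑ m ∈ intBox x,
      (if n.2 ^ (e + 1) * m.1 ^ (e + 1) - n.1 ^ (e + 1) * m.2 ^ (e + 1) = 0 then G n / 2 else 0) ≤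
      (if n = 0 then 9 * x ^ 2 * (B ^ 2 * (3 * H) ^ (e + 2)) / 2 else 0) +
        6 * x * (K * H ^ (e + 2) * √x * (1 + Real.log H) ^ M) / 2 := by
    intro n hn
    rw [← Finset.sum_filter, Finset.sum_const, nsmul_eq_mul, mul_div_assoc']
    by_cases h0 : n = 0
    · rw [if_pos h0]
      have h1 : G n ≤ B ^ 2 * (3 * H) ^ (e + 2) := by
        rw [h0]
        exact sum_norm_sq_eval_zero_le (by simpa using hf 0) e (by linarith)
      have h2 : (((intBox x).filter fun m =>
          n.2 ^ (e + 1) * m.1 ^ (e + 1) - n.1 ^ (e + 1) * m.2 ^ (e + 1) = 0).card : ℝ) ≤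
          9 * x ^ 2 :=
        (Nat.cast_le.mpr (Finset.card_filter_le _ _)).trans (card_intBox_le hx)
      have h3 := mul_le_mul h2 h1 (hG0 n) (by positivity)
      have h4 : 0 ≤ 6 * x * (K * H ^ (e + 2) * √x * (1 + Real.log H) ^ M) / 2 := by positivity
      linarith
    · rw [if_neg h0, zero_add]
      have h1 := mul_le_mul (card_degenerate_le hx (Nat.succ_ne_zero e) h0)
        (hmom f hf H x n hH hx hxH hn h0) (hG0 n) (by positivity)
      linarith
  have htot : ∑ n ∈ intBox x, ∑ m ∈ intBox x,
      (if n.2 ^ (e + 1) * m.1 ^ (e + 1) - n.1 ^ (e + 1) * m.2 ^ (e + 1) = 0 then G n / 2 else 0) ≤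
      9 * x ^ 2 * (B ^ 2 * (3 * H) ^ (e + 2)) / 2 +
        9 * x ^ 2 * (6 * x * (K * H ^ (e + 2) * √x * (1 + Real.log H) ^ M) / 2) := by
    refine (Finset.sum_le_sum hone).trans ?_
    rw [Finset.sum_add_distrib, Finset.sum_const, nsmul_eq_mul]
    refine add_le_add ?_ (mul_le_mul_of_nonneg_right (card_intBox_le hx) (by positivity))
    rw [Finset.sum_ite_eq']
    split_ifs
    · exact le_rfl
    · positivity
  have hsum := Finset.sum_le_sum fun n hn => Finset.sum_le_sum (hpair n hn)
  simp only [Finset.sum_add_distrib] at hsum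
  rw [Finset.sum_comm (f := fun n m : ℤ × ℤ =>
    if m.2 ^ (e + 1) * n.1 ^ (e + 1) - m.1 ^ (e + 1) * n.2 ^ (e + 1) = 0 then G m / 2
      else 0)] at hsum
  refine hsum.trans ((add_le_add htot htot).trans ?_)
  have h1 : 1 ≤ √x * (1 + Real.log H) ^ M :=
    one_le_mul_of_one_le_of_one_le (Real.one_le_sqrt.mpr hx) (one_le_pow₀ (by linarith))
  have h2 : x ^ 2 ≤ x ^ 3 := pow_le_pow_right₀ hx (by norm_num)
  have h3 : x ^ 2 ≤ x ^ 3 * (√x * (1 + Real.log H) ^ M) :=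
    h2.trans (le_mul_of_one_le_right (by positivity) h1)
  have h4 := mul_le_mul_of_nonneg_right h3
    (show 0 ≤ 9 * (B ^ 2 * (3 * H) ^ (e + 2)) by positivity)
  rw [mul_pow] at h4 ⊢
  calc _ = x ^ 2 * (9 * (B ^ 2 * (3 ^ (e + 2) * H ^ (e + 2)))) +
        54 * K * H ^ (e + 2) * (x ^ 3 * √x) * (1 + Real.log H) ^ M := by ring
    _ ≤ _ := (add_le_add_left h4 _).trans (le_of_eq (by ring))

theorem sum_norm_le_of_bound {f : ℤ → ℂ} {B : ℝ} (hB : 0 ≤ B) {c : ℕ}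
    (hf : ∀ n : ℤ, ‖f n‖ ≤ B * (if n = 0 then 1 else (tau n.natAbs : ℝ) ^ c)) (e : ℕ) {H x : ℝ}
    (hH : 3 ≤ H) (hL : 1 ≤ Real.log H) (hx : 1 ≤ x) (hxH : x ≤ H) :
    ∑ k ∈ Finset.Icc ⌈-((1 + ((e + 1 : ℕ) : ℝ)) * x ^ (e + 1) * H)⌉
        ⌊(1 + ((e + 1 : ℕ) : ℝ)) * x ^ (e + 1) * H⌋, ‖f k‖ ≤
      3 * B * (1 + ((e + 1 : ℕ) : ℝ)) * (2 * (e + 1) + 2) ^ 2 ^ c *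
        (x ^ (e + 1) * H * Real.log H ^ 2 ^ c) := by
  have hT1 : 1 ≤ (1 + ((e + 1 : ℕ) : ℝ)) * x ^ (e + 1) * H :=
    one_le_mul_of_one_le_of_one_le (one_le_mul_of_one_le_of_one_le
      (by simp only [le_add_iff_nonneg_right]; positivity) (one_le_pow₀ hx)) (by linarith)
  have hTle := linear_value_bound_le (e := e) (by linarith : (2 : ℝ) ≤ H) (by linarith) hxH
  set T := (1 + ((e + 1 : ℕ) : ℝ)) * x ^ (e + 1) * H with hT
  have hlog : Real.log T ≤ (2 * (e + 1) + 1) * Real.log H := by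
    have := Real.log_le_log (by linarith) hTle
    rw [Real.log_pow] at this
    push_cast at this
    exact this
  have hlog0 : 0 ≤ Real.log T := Real.log_nonneg hT1
  have h1 : 1 + Real.log T ≤ (2 * (e + 1) + 2) * Real.log H := by linarith
  refine (sum_norm_Icc_ceil_floor_le hB hf hT1).trans ?_
  calc 3 * B * T * (1 + Real.log T) ^ 2 ^ c ≤
        3 * B * T * ((2 * (e + 1) + 2) * Real.log H) ^ 2 ^ c := by gcongr
    _ = _ := by rw [hT, mul_pow]; ring

/-- AM-GM with the weight `L^(-N/2)` on one side: the discrepancy becomes squared, at the price of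
more logarithms and an error `L^(-N)`. -/
theorem pow_mul_le_rpow_mul_sq_add {L y N κ : ℝ} (hL : 1 ≤ L) (hy : 0 ≤ y) (M : ℕ)
    (hκ : 2 * M + N ≤ κ) : L ^ M * y ≤ L ^ κ * y ^ 2 + L ^ (-N) := by
  have hL0 : 0 < L := by linarith
  have h1 : L ^ M = L ^ ((M : ℝ) + N / 2) * L ^ (-(N / 2)) := by
    rw [← Real.rpow_add hL0, ← Real.rpow_natCast]
    congr 1
    ring
  have h2 : (L ^ ((M : ℝ) + N / 2)) ^ 2 ≤ L ^ κ := by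
    rw [← Real.rpow_natCast, ← Real.rpow_mul hL0.le]
    exact Real.rpow_le_rpow_of_exponent_le hL (by push_cast; linarith)
  have h3 : (L ^ (-(N / 2))) ^ 2 = L ^ (-N) := by
    rw [← Real.rpow_natCast, ← Real.rpow_mul hL0.le]
    congr 1
    push_cast
    ring
  have h4 := mul_le_mul_of_nonneg_right h2 (sq_nonneg y)
  have h5 := two_mul_le_add_sq (L ^ ((M : ℝ) + N / 2) * y) (L ^ (-(N / 2)))
  have h6 : 0 ≤ L ^ ((M : ℝ) + N / 2) * y * L ^ (-(N / 2)) := by positivity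
  rw [h1]
  rw [mul_pow, h3] at h5
  nlinarith

theorem pow_div_sqrt_le_rpow_neg {L x N κ : ℝ} (hL : 1 ≤ L) (M : ℕ) (hκ : 2 * M + 2 * N ≤ κ)
    (hx : L ^ κ ≤ x) : L ^ M / √x ≤ L ^ (-N) := by
  have hL0 : 0 < L := by linarith
  have h1 : L ^ ((M : ℝ) + N) ≤ √x := by
    refine Real.le_sqrt_of_sq_le (le_trans ?_ hx)
    rw [← Real.rpow_natCast, ← Real.rpow_mul hL0.le]
    exact Real.rpow_le_rpow_of_exponent_le hL (by push_cast; linarith)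
  have h2 : 0 < √x := (Real.rpow_pos_of_pos hL0 _).trans_le h1
  rw [div_le_iff₀ h2]
  calc L ^ M = L ^ (-N) * L ^ ((M : ℝ) + N) := by
        rw [← Real.rpow_add hL0, ← Real.rpow_natCast]
        congr 1
        ring
    _ ≤ _ := by gcongr

/-- The dispersion bound, before the discrepancy is separated from the logarithms. -/
theorem exists_secondMoment_le {B : ℝ} (hB : 0 < B) (c e : ℕ) :
    ∃ K : ℝ, 0 < K ∧ ∃ M : ℕ, ∀ f : ℤ → ℂ,
      (∀ n : ℤ, ‖f n‖ ≤ B * (if n = 0 then 1 else (tau n.natAbs : ℝ) ^ c)) →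
      ∀ H x : ℝ, 3 ≤ H → 1 ≤ Real.log H → 1 ≤ x → x ≤ H →
      1 / H ^ (1 + (e + 1)) * ∑ F ∈ formsOfHeight (e + 1) H,
          ‖1 / (x : ℂ) ^ 2 * ∑ n ∈ intBox x, f (MvPolynomial.eval ![n.1, n.2] F)‖ ^ 2 ≤
        K * (Real.log H ^ 2 ^ c * (x ^ (e + 1) *
          √(maxSqDiscrepancy f ((1 + ((e + 1 : ℕ) : ℝ)) * x ^ (e + 1) * H)
            (2 * x ^ (2 * (e + 1)))) / H) + Real.log H ^ M / √x) := by
  obtain ⟨K₀, hK₀, M, hdeg⟩ := exists_sum_degenerate_le hB c e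
  set K₁ : ℝ := 3 * B * (1 + ((e + 1 : ℕ) : ℝ)) * (2 * (e + 1) + 2) ^ 2 ^ c with hK₁
  have hK₁0 : 0 < K₁ := by positivity
  -- Here `162 = 2 · 9 · 9`, from the two sums over the box and the factor `2` of the line sum;
  -- `2^M` comes from `1 + log H ≤ 2 log H`.
  refine ⟨162 * 3 ^ e * K₁ + K₀ * 2 ^ M, by positivity, M, fun f hf H x hH hL hx hxH => ?_⟩
  have hH0 : 0 < H := by linarith
  have hx0 : 0 < x := by linarith
  have hL0 : 0 < Real.log H := by linarith
  set E := √(maxSqDiscrepancy f ((1 + ((e + 1 : ℕ) : ℝ)) * x ^ (e + 1) * H)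
    (2 * x ^ (2 * (e + 1)))) with hE
  have hE0 : 0 ≤ E := Real.sqrt_nonneg _
  have hW := sum_norm_le_of_bound hB.le hf e hH hL hx hxH
  rw [← hK₁] at hW
  set P := (3 * H) ^ e * ((K₁ * (x ^ (e + 1) * H * Real.log H ^ 2 ^ c)) * (2 * E)) with hP
  have hP0 : 0 ≤ P := by positivity
  have hpair : ∀ n ∈ intBox x, ∀ m ∈ intBox x,
      ‖∑ F ∈ formsOfHeight (e + 1) H, f (MvPolynomial.eval ![n.1, n.2] F) *
        starRingEnd ℂ (f (MvPolynomial.eval ![m.1, m.2] F))‖ ≤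
      P + (if n.2 ^ (e + 1) * m.1 ^ (e + 1) - n.1 ^ (e + 1) * m.2 ^ (e + 1) = 0 then
          ‖∑ F ∈ formsOfHeight (e + 1) H, f (MvPolynomial.eval ![n.1, n.2] F) *
            starRingEnd ℂ (f (MvPolynomial.eval ![m.1, m.2] F))‖ else 0) := by
    intro n hn m hm
    split_ifs with hD
    · linarith
    · rw [add_zero]
      refine (norm_sum_pair_le_of_independent f e (by linarith) hn hm hD).trans ?_
      rw [hP]
      exact mul_le_mul_of_nonneg_left (mul_le_mul_of_nonneg_right hW (by positivity))
        (by positivity)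
  have hbox := card_intBox_le hx
  have hS : ∑ F ∈ formsOfHeight (e + 1) H,
      ‖∑ n ∈ intBox x, f (MvPolynomial.eval ![n.1, n.2] F)‖ ^ 2 ≤
      (9 * x ^ 2) * ((9 * x ^ 2) * P) +
        K₀ * H ^ (e + 2) * (x ^ 3 * √x) * (1 + Real.log H) ^ M := by
    refine (sum_norm_sum_sq_le _ _ _).trans
      ((Finset.sum_le_sum fun n hn => Finset.sum_le_sum (hpair n hn)).trans ?_)
    simp only [Finset.sum_add_distrib, Finset.sum_const, nsmul_eq_mul]
    refine add_le_add ?_ (hdeg f hf H x (by linarith) hx hxH)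
    gcongr
  have hLM : (1 + Real.log H) ^ M ≤ 2 ^ M * Real.log H ^ M := by
    rw [← mul_pow]
    exact pow_le_pow_left₀ (by linarith) (by linarith) M
  have hnorm : ∀ z : ℂ, ‖1 / (x : ℂ) ^ 2 * z‖ ^ 2 = 1 / x ^ 4 * ‖z‖ ^ 2 := by
    intro z
    rw [norm_mul, norm_div, norm_one, norm_pow, Complex.norm_real, Real.norm_of_nonneg hx0.le]
    ring
  simp only [hnorm]
  rw [← Finset.mul_sum]
  have hsq : √x * √x = x := Real.mul_self_sqrt hx0.le
  have hsq0 : 0 < √x := Real.sqrt_pos.mpr hx0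
  set u := Real.log H ^ 2 ^ c * (x ^ (e + 1) * E / H) with hu
  set v := Real.log H ^ M / √x with hv
  have hu0 : 0 ≤ u := by positivity
  have hv0 : 0 ≤ v := by positivity
  have hdiv : x ^ 3 * √x = x ^ 4 / √x := by
    rw [eq_div_iff hsq0.ne', mul_assoc, hsq]
    ring
  calc 1 / H ^ (1 + (e + 1)) * (1 / x ^ 4 * ∑ F ∈ formsOfHeight (e + 1) H,
        ‖∑ n ∈ intBox x, f (MvPolynomial.eval ![n.1, n.2] F)‖ ^ 2)
      ≤ 1 / H ^ (1 + (e + 1)) * (1 / x ^ 4 * ((9 * x ^ 2) * ((9 * x ^ 2) * P) +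
        K₀ * H ^ (e + 2) * (x ^ 3 * √x) * (2 ^ M * Real.log H ^ M))) := by
        have : K₀ * H ^ (e + 2) * (x ^ 3 * √x) * (1 + Real.log H) ^ M ≤
            K₀ * H ^ (e + 2) * (x ^ 3 * √x) * (2 ^ M * Real.log H ^ M) := by gcongr
        have h2 := hS.trans (add_le_add_right this _)
        gcongr
    _ = 162 * 3 ^ e * K₁ * u + K₀ * 2 ^ M * v := by
        rw [hdiv, hP, hu, hv, mul_pow]
        field_simp
        ring
    _ ≤ _ := by
        have h1 : 0 ≤ 162 * 3 ^ e * K₁ * v := by positivity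
        have h2 : 0 ≤ K₀ * 2 ^ M * u := by positivity
        linarith

theorem mainTheorem7 (B C : ℝ) (hB : 0 < B) (hC : 0 < C) (N : ℝ) (hN : 0 < N)
    (d : ℕ) (hd : 0 < d) :
    ∃ κ : ℝ, 0 < κ ∧ ∃ K : ℝ, 0 < K ∧
      ∀ f : ℤ → ℂ,
        (∀ n : ℤ, ‖f n‖ ≤ B * (if n = 0 then 1 else (tau n.natAbs : ℝ) ^ C)) →
        ∀ H x : ℝ, 3 ≤ H → Real.log H ^ κ ≤ x → x ≤ H →
          1 / H ^ (1 + d) *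
              ∑ F ∈ formsOfHeight d H,
                ‖1 / (x : ℂ) ^ 2 *
                  ∑ n ∈ intBox x, f (MvPolynomial.eval ![n.1, n.2] F)‖ ^ 2
            ≤ K * (Real.log H ^ κ * x ^ (4 * d) / H ^ 2 *
                  maxSqDiscrepancy f ((1 + (d : ℝ)) * x ^ d * H) (2 * x ^ (2 * d))
                + 1 / Real.log x ^ N) := by
  obtain ⟨e, rfl⟩ : ∃ e, d = e + 1 := ⟨d - 1, by omega⟩
  set c := ⌈C⌉₊ with hc
  obtain ⟨K₀, hK₀, M, hmain⟩ := exists_secondMoment_le hB c e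
  -- This `κ` serves both ends: AM-GM needs `2 · 2^c + N`, and absorbing `(log H)^M / √x` needs `2M
  -- + 2N`. The factor `2` in `2 * K₀` allows for the two errors `(log H)^(-N)`.
  refine ⟨2 * ((2 ^ c : ℕ) : ℝ) + 2 * M + 2 * N, by positivity, 2 * K₀, by positivity,
    fun f hf H x hH hκx hxH => ?_⟩
  set κ : ℝ := 2 * ((2 ^ c : ℕ) : ℝ) + 2 * M + 2 * N with hκ
  have hκ0 : 0 < κ := by positivity
  have hH0 : 0 < H := by linarith
  -- Since `H ≥ 3 > e`, this is strict, whence also `x > 1` and `log x > 0`.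
  have hL : 1 < Real.log H := by
    rw [Real.lt_log_iff_exp_lt hH0]
    linarith [Real.exp_one_lt_d9]
  have hx : 1 < x := (Real.one_lt_rpow hL hκ0).trans_le hκx
  have hf' : ∀ n : ℤ, ‖f n‖ ≤ B * (if n = 0 then 1 else (tau n.natAbs : ℝ) ^ c) := by
    intro n
    refine (hf n).trans (mul_le_mul_of_nonneg_left ?_ hB.le)
    split_ifs with hn
    · exact le_rfl
    · rw [← Real.rpow_natCast]
      refine Real.rpow_le_rpow_of_exponent_le ?_ (Nat.le_ceil C)
      exact_mod_cast tau_pos (Int.natAbs_ne_zero.mpr hn)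
  refine (hmain f hf' H x hH hL.le hx.le hxH).trans ?_
  set X := maxSqDiscrepancy f ((1 + ((e + 1 : ℕ) : ℝ)) * x ^ (e + 1) * H)
    (2 * x ^ (2 * (e + 1))) with hX
  have hX0 : 0 ≤ X := maxSqDiscrepancy_nonneg _ _ _
  have h1 := pow_mul_le_rpow_mul_sq_add (N := N) (κ := κ) (y := x ^ (e + 1) * √X / H) hL.le
    (by positivity) (2 ^ c) (by rw [hκ]; linarith [Nat.cast_nonneg (α := ℝ) M])
  have h2 := pow_div_sqrt_le_rpow_neg (N := N) (κ := κ) hL.le M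
    (by rw [hκ]; linarith [Nat.cast_nonneg (α := ℝ) (2 ^ c)]) hκx
  have h3 : Real.log H ^ (-N) ≤ 1 / Real.log x ^ N := by
    rw [Real.rpow_neg (by linarith), ← one_div]
    have hlx : 0 < Real.log x := Real.log_pos hx
    have := Real.log_le_log (by linarith) hxH
    gcongr
  have h4 : Real.log H ^ κ * (x ^ (e + 1) * √X / H) ^ 2 ≤
      Real.log H ^ κ * x ^ (4 * (e + 1)) / H ^ 2 * X := by
    -- The argument yields `x^(2d)`; the stated power `x^(4d)` is weaker.
    have hxp : (x ^ (e + 1)) ^ 2 ≤ x ^ (4 * (e + 1)) := by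
      rw [← pow_mul]
      exact pow_le_pow_right₀ hx.le (by omega)
    calc _ = Real.log H ^ κ * (x ^ (e + 1)) ^ 2 / H ^ 2 * X := by
          rw [div_pow, mul_pow, Real.sq_sqrt hX0]
          ring
      _ ≤ _ := by gcongr
  have h5 : 0 ≤ Real.log H ^ κ * x ^ (4 * (e + 1)) / H ^ 2 * X := by positivity
  nlinarith
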